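/- Let $X$ be a simplicial set with a single vertex $x$ (that is, $X_0=\{x\}$), let $|X|$ be its geometric realization and let $G=\pi_1(|X|,x)$, where the product $gh$ in $G$ means "first $g$, then $h$". For $a\in X_1$ let $g_a\in G$ be the class of the loop in $|X|$ obtained by traversing the realization of $a$ from its initial to its final vertex. Let $I$ be the augmentation ideal of $\mathbb{Z}G$ and put $D^{(k)}(G)=\mathbb{Z}G/I^k$ for an integer $k\ge 0$. Let $C=C(X)$ be the (unnormalized) integral chain complex of $X$, free on all simplices, with differential $\delta$ and the comultiplication $\Delta\sigma=\sum_{i+j=n}{}_{(i)}\sigma\otimes\sigma_{(j)}$ for an $n$-simplex $\sigma$, where ${}_{(i)}\sigma$ is the front $i$-face and $\sigma_{(j)}$ the back $j$-face of $\sigma$. Let $\bar C=C/C_0$ with the induced differential $\delta$ and comultiplication $\bar\Delta$. Let $\mathcal{F}(C)=T(s^{-1}\bar C)$ be the cobar construction: the tensor algebra on the desuspension of $\bar C$ (so $[c]=s^{-1}c$ has degree $\deg c-1$), graded by total degree, whose differential is the graded derivation with $$\partial[c]=-[\delta c]+\sum_i(-1)^{\deg a_i}[a_i|b_i],\qquad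 \bar\Delta c=\sum_i a_i\otimes b_i .$$ Let $\mathcal{F}^{(k)}(C)=\mathcal{F}(C)/(T^k(s^{-1}\bar C))$ be its quotient by the ideal $\bigoplus_{r\ge k}T^r(s^{-1}\bar C)$, which is a subcomplex, and let $A^{(k)}(X)=H_0(\mathcal{F}^{(k)}(C))$ with its induced ring structure. Then for every $k\ge 0$ there is a ring isomorphism $D^{(k)}(G)\to A^{(k)}(X)$ that, for each $a\in X_1$, sends the image of $g_a$ in $D^{(k)}(G)$ to the class of $1+[a]$ in $A^{(k)}(X)$. -/

import Mathlib

open CategoryTheory Simplicial TensorProduct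

universe u

noncomputable section

namespace CobarPi

/-! ### The quotients `ℤG / I ^ k` of an integral group ring -/

/-- The augmentation ideal of `ℤG`: the kernel of the ring homomorphism `ℤG → ℤ` sending every
`g : G` to `1`. -/
def augIdeal (G : Type u) [Group G] : Ideal (MonoidAlgebra ℤ G) :=
  RingHom.ker (MonoidAlgebra.lift ℤ ℤ G (1 : G →* ℤ))

instance (G : Type u) [Group G] : (augIdeal G).IsTwoSided := by
  unfold augIdeal
  infer_instance

/-- `D^(k)(G) = ℤG / I ^ k`. -/
abbrev DQuot (G : Type u) [Group G] (k : ℕ) : Type u :=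
  MonoidAlgebra ℤ G ⧸ augIdeal G ^ k

/-- The image of a group element in `ℤG / I ^ k`. -/
def DQuot.of {G : Type u} [Group G] (k : ℕ) (g : G) : DQuot G k :=
  Ideal.Quotient.mk (augIdeal G ^ k) (MonoidAlgebra.of ℤ G g)

/-! ### The fundamental group of the geometric realization -/

/-- The fundamental group with the classical convention for products: `g * h` is the class of
"first `g`, then `h`". Mathlib's `FundamentalGroup` has the opposite multiplication
(`p * q = q.trans p`), hence the `ᵐᵒᵖ`. -/
abbrev Pi1 (Y : Type u) [TopologicalSpace Y] (y : Y) : Type u :=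
  (FundamentalGroup Y y)ᵐᵒᵖ

/-- The homotopy class of a loop as an element of the fundamental group. -/
def Pi1.mk {Y : Type u} [TopologicalSpace Y] {y : Y} (p : Path y y) : Pi1 Y y :=
  MulOpposite.op (FundamentalGroup.fromPath (Path.Homotopic.Quotient.mk p))

theorem Pi1.mk_mul_mk {Y : Type u} [TopologicalSpace Y] {y : Y} (p q : Path y y) :
    Pi1.mk p * Pi1.mk q = Pi1.mk (p.trans q) := rfl

/-- The characteristic map of a simplex in the geometric realization. -/
def simplexMap (X : SSet.{u}) {n : ℕ} (σ : X _⦋n⦌) :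
    C(stdSimplex ℝ (Fin (n + 1)), |X|) :=
  TopCat.toSSetObjEquiv |X| _ ((sSetTopAdj.unit.app X).app _ σ)

/-- The point of `|X|` given by a vertex of `X`. -/
def vertexPoint (X : SSet.{u}) (x : X _⦋0⦌) : |X| := simplexMap X x default

theorem simplexMap_δ (X : SSet.{u}) {n : ℕ} (σ : X _⦋n + 1⦌) (i : Fin (n + 2))
    (z : stdSimplex ℝ (Fin (n + 1))) :
    simplexMap X (X.δ i σ) z = simplexMap X σ (stdSimplex.map i.succAbove z) := by
  have h : (sSetTopAdj.unit.app X).app _ (X.δ i σ) =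
      (TopCat.toSSet.obj |X|).δ i ((sSetTopAdj.unit.app X).app _ σ) :=
    SSet.δ_naturality_apply (sSetTopAdj.unit.app X) i σ
  have h' : simplexMap X (X.δ i σ) = TopCat.toSSetObjEquiv |X| _
      ((TopCat.toSSet.obj |X|).δ i ((sSetTopAdj.unit.app X).app _ σ)) :=
    congrArg (TopCat.toSSetObjEquiv |X| (Opposite.op ⦋n⦌)) h
  rw [h', simplexMap]
  exact TopCat.toSSetObjEquiv_δ_apply _ i z

/-- A `1`-simplex `a` gives the path `t ↦ (1 - t) v₀ + t v₁` in `|X|`, running from its initial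
vertex `d₁ a` to its final vertex `d₀ a`. -/
def edgePath (X : SSet.{u}) (a : X _⦋1⦌) :
    Path (vertexPoint X (X.δ 1 a)) (vertexPoint X (X.δ 0 a)) where
  toFun t := simplexMap X a (stdSimplexHomeomorphUnitInterval.symm t)
  continuous_toFun := by fun_prop
  source' := by
    rw [vertexPoint, simplexMap_δ]
    congr 1
    rw [Subsingleton.elim (default : stdSimplex ℝ (Fin (0 + 1))) (stdSimplex.vertex 0),
      stdSimplex.map_vertex, Homeomorph.symm_apply_eq]
    rfl
  target' := by
    rw [vertexPoint, simplexMap_δ]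
    congr 1
    rw [Subsingleton.elim (default : stdSimplex ℝ (Fin (0 + 1))) (stdSimplex.vertex 0),
      stdSimplex.map_vertex, Homeomorph.symm_apply_eq]
    rfl

/-- The element `g_a` of `π₁(|X|, x)` given by a `1`-simplex `a` of a simplicial set `X` with the
single vertex `x`. -/
def edgeClass (X : SSet.{u}) (x : X _⦋0⦌) (hx : ∀ y : X _⦋0⦌, y = x) (a : X _⦋1⦌) :
    Pi1 |X| (vertexPoint X x) :=
  Pi1.mk ((edgePath X a).cast (by rw [hx (X.δ 1 a)]) (by rw [hx (X.δ 0 a)]))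

/-! ### The chain coalgebra of a simplicial set -/

/-- The total module of the (unnormalized) integral chain complex `C(X)`: it is free on the
simplices of all dimensions. -/
abbrev Chains (X : SSet.{u}) : Type u := (Σ n : ℕ, X _⦋n⦌) →₀ ℤ

/-- A simplex as a chain. -/
def simplexChain (X : SSet.{u}) {n : ℕ} (σ : X _⦋n⦌) : Chains X :=
  Finsupp.single ⟨n, σ⟩ 1

/-- The boundary of a simplex. -/
def boundaryOn (X : SSet.{u}) (n : ℕ) : X _⦋n⦌ → Chains X :=
  Nat.casesOn (motive := fun n => X _⦋n⦌ → Chains X) n (fun _ => 0)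
    (fun m σ => ∑ i : Fin (m + 2), (-1 : ℤ) ^ (i : ℕ) • simplexChain X (X.δ i σ))

/-- The differential of `C(X)`. -/
def boundary (X : SSet.{u}) : Chains X →ₗ[ℤ] Chains X :=
  Finsupp.linearCombination ℤ fun s : (Σ n : ℕ, X _⦋n⦌) => boundaryOn X s.1 s.2

/-- The front `p`-dimensional face of an `n`-simplex (vertices `0, …, p`). -/
def frontFace (X : SSet.{u}) {n : ℕ} (σ : X _⦋n⦌) (p : Fin (n + 1)) : X _⦋(p : ℕ)⦌ :=
  X.map (SimplexCategory.subinterval 0 p (by omega)).op σ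

/-- The back `(n - p)`-dimensional face of an `n`-simplex (vertices `p, …, n`). -/
def backFace (X : SSet.{u}) {n : ℕ} (σ : X _⦋n⦌) (p : Fin (n + 1)) : X _⦋n - (p : ℕ)⦌ :=
  X.map (SimplexCategory.subinterval p (n - p) (by omega)).op σ

/-- The Alexander–Whitney comultiplication of `C(X)`. -/
def comul (X : SSet.{u}) : Chains X →ₗ[ℤ] Chains X ⊗[ℤ] Chains X :=
  Finsupp.linearCombination ℤ fun s : (Σ n : ℕ, X _⦋n⦌) =>
    ∑ p : Fin (s.1 + 1), simplexChain X (frontFace X s.2 p) ⊗ₜ[ℤ] simplexChain X (backFace X s.2 p)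

/-- The map multiplying an `n`-chain by `(-1) ^ n`. -/
def chainSign (X : SSet.{u}) : Chains X →ₗ[ℤ] Chains X :=
  Finsupp.linearCombination ℤ fun s : (Σ n : ℕ, X _⦋n⦌) => (-1 : ℤ) ^ s.1 • simplexChain X s.2

/-- The submodule `C₀` of `0`-chains. -/
def zeroChains (X : SSet.{u}) : Submodule ℤ (Chains X) :=
  Submodule.span ℤ (Set.range fun x : X _⦋0⦌ => simplexChain X x)

/-- `C̄ = C / C₀`. -/
abbrev RedChains (X : SSet.{u}) : Type u := Chains X ⧸ zeroChains X

theorem boundary_simplexChain_zero (X : SSet.{u}) (x : X _⦋0⦌) :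
    boundary X (simplexChain X x) = 0 := by
  simp [boundary, simplexChain, boundaryOn]

theorem comul_simplexChain (X : SSet.{u}) {n : ℕ} (σ : X _⦋n⦌) :
    comul X (simplexChain X σ) = ∑ p : Fin (n + 1),
      simplexChain X (frontFace X σ p) ⊗ₜ[ℤ] simplexChain X (backFace X σ p) := by
  simp [comul, simplexChain]

theorem chainSign_simplexChain (X : SSet.{u}) {n : ℕ} (σ : X _⦋n⦌) :
    chainSign X (simplexChain X σ) = (-1 : ℤ) ^ n • simplexChain X σ := by
  simp [chainSign, simplexChain]

/-- The class of a simplex in `C̄`. -/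
def redSimplex (X : SSet.{u}) {n : ℕ} (σ : X _⦋n⦌) : RedChains X :=
  (zeroChains X).mkQ (simplexChain X σ)

theorem redSimplex_zero (X : SSet.{u}) {n : ℕ} (hn : n = 0) (x : X _⦋n⦌) :
    redSimplex X x = 0 := by
  subst hn
  exact (Submodule.Quotient.mk_eq_zero _).2 (Submodule.subset_span ⟨x, rfl⟩)

/-- The differential of `C̄`. -/
def redBoundary (X : SSet.{u}) : RedChains X →ₗ[ℤ] RedChains X :=
  (zeroChains X).mapQ (zeroChains X) (boundary X) <| by
    refine Submodule.span_le.2 ?_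
    rintro _ ⟨x, rfl⟩
    simp [boundary_simplexChain_zero]

/-- The map `(-1) ^ deg` on `C̄`. -/
def redSign (X : SSet.{u}) : RedChains X →ₗ[ℤ] RedChains X :=
  (zeroChains X).mapQ (zeroChains X) (chainSign X) <| by
    refine Submodule.span_le.2 ?_
    rintro _ ⟨x, rfl⟩
    have h : simplexChain X x ∈ zeroChains X := Submodule.subset_span ⟨x, rfl⟩
    simpa [chainSign_simplexChain] using h

/-- The comultiplication of `C̄` induced by that of `C`. -/
def redComul (X : SSet.{u}) : RedChains X →ₗ[ℤ] RedChains X ⊗[ℤ] RedChains X :=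
  (zeroChains X).liftQ
    (TensorProduct.map (zeroChains X).mkQ (zeroChains X).mkQ ∘ₗ comul X) <| by
    refine Submodule.span_le.2 ?_
    rintro _ ⟨x, rfl⟩
    change TensorProduct.map _ _ (comul X (simplexChain X x)) = 0
    rw [comul_simplexChain, map_sum]
    refine Finset.sum_eq_zero fun p _ => ?_
    rw [TensorProduct.map_tmul]
    change redSimplex X _ ⊗ₜ redSimplex X _ = 0
    rw [redSimplex_zero X (by omega), TensorProduct.zero_tmul]

theorem redComul_redSimplex (X : SSet.{u}) {n : ℕ} (σ : X _⦋n⦌) :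
    redComul X (redSimplex X σ) = ∑ p : Fin (n + 1),
      redSimplex X (frontFace X σ p) ⊗ₜ[ℤ] redSimplex X (backFace X σ p) := by
  change TensorProduct.map _ _ (comul X (simplexChain X σ)) = _
  rw [comul_simplexChain, map_sum]
  rfl

theorem redBoundary_redSimplex (X : SSet.{u}) {n : ℕ} (σ : X _⦋n + 1⦌) :
    redBoundary X (redSimplex X σ) =
      ∑ i : Fin (n + 2), (-1 : ℤ) ^ (i : ℕ) • redSimplex X (X.δ i σ) := by
  change (zeroChains X).mkQ (boundary X (simplexChain X σ)) = _
  have h : boundary X (simplexChain X σ) =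
      ∑ i : Fin (n + 2), (-1 : ℤ) ^ (i : ℕ) • simplexChain X (X.δ i σ) := by
    simp [boundary, simplexChain, boundaryOn]
  rw [h, map_sum]
  simp only [map_smul]
  rfl

theorem redSign_redSimplex (X : SSet.{u}) {n : ℕ} (σ : X _⦋n⦌) :
    redSign X (redSimplex X σ) = (-1 : ℤ) ^ n • redSimplex X σ := by
  change (zeroChains X).mkQ (chainSign X (simplexChain X σ)) = _
  rw [chainSign_simplexChain, map_smul]
  rfl

/-! ### The cobar construction -/

/-- The cobar construction `T(s⁻¹ C̄)`. The desuspension `s⁻¹` leaves the module `C̄` unchanged and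
only shifts degrees: `[σ]` has degree `n - 1` for an `n`-simplex `σ`. -/
abbrev Cobar (X : SSet.{u}) : Type u := TensorAlgebra ℤ (RedChains X)

/-- The linear map `c ↦ [c]`. -/
def bracket (X : SSet.{u}) : RedChains X →ₗ[ℤ] Cobar X := TensorAlgebra.ι ℤ

/-- The generator `[σ]` given by a simplex. -/
def gen (X : SSet.{u}) {n : ℕ} (σ : X _⦋n⦌) : Cobar X := bracket X (redSimplex X σ)

/-- The algebra automorphism which is `(-1) ^ n` on elements of degree `n`; on generators it is
`[c] ↦ (-1) ^ (deg c - 1) [c]`. -/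
def cobarSign (X : SSet.{u}) : Cobar X →ₐ[ℤ] Cobar X :=
  TensorAlgebra.lift ℤ (-(bracket X ∘ₗ redSign X))

/-- The differential on generators: `c ↦ -[δ c] + ∑ (-1) ^ deg aᵢ [aᵢ | bᵢ]`, where
`Δ̄ c = ∑ aᵢ ⊗ bᵢ`. -/
def cobarDGen (X : SSet.{u}) : RedChains X →ₗ[ℤ] Cobar X :=
  -(bracket X ∘ₗ redBoundary X) +
    LinearMap.mul' ℤ (Cobar X) ∘ₗ
      TensorProduct.map (bracket X ∘ₗ redSign X) (bracket X) ∘ₗ redComul X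

theorem cobarDGen_apply (X : SSet.{u}) (c : RedChains X) :
    cobarDGen X c = -bracket X (redBoundary X c) + LinearMap.mul' ℤ (Cobar X)
      (TensorProduct.map (bracket X ∘ₗ redSign X) (bracket X) (redComul X c)) := rfl

/-- Auxiliary: the algebra map `u ↦ !![± u, ∂ u; 0, u]`, whose multiplicativity encodes the graded
Leibniz rule for `∂`. -/
def cobarMatrix (X : SSet.{u}) : Cobar X →ₐ[ℤ] Matrix (Fin 2) (Fin 2) (Cobar X) :=
  TensorAlgebra.lift ℤ
    { toFun := fun c => !![cobarSign X (bracket X c), cobarDGen X c; 0, bracket X c]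
      map_add' := fun c c' => by
        ext i j
        fin_cases i <;> fin_cases j <;> simp
      map_smul' := fun r c => by
        ext i j
        fin_cases i <;> fin_cases j <;> simp }

/-- The differential of the cobar construction: the unique graded derivation extending `cobarDGen`
(see `cobarD_bracket` and `cobarD_mul`). -/
def cobarD (X : SSet.{u}) : Cobar X →ₗ[ℤ] Cobar X where
  toFun u := cobarMatrix X u 0 1
  map_add' u v := by simp
  map_smul' r u := by rw [map_smul, Matrix.smul_apply]; rfl

theorem cobarMatrix_bracket (X : SSet.{u}) (c : RedChains X) :
    cobarMatrix X (bracket X c) =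
      !![cobarSign X (bracket X c), cobarDGen X c; 0, bracket X c] := by
  simp [cobarMatrix, bracket]

theorem cobarMatrix_entries (X : SSet.{u}) (u : Cobar X) :
    cobarMatrix X u 0 0 = cobarSign X u ∧ cobarMatrix X u 1 0 = 0 ∧ cobarMatrix X u 1 1 = u := by
  induction u using TensorAlgebra.induction with
  | algebraMap r =>
    rw [AlgHom.commutes, AlgHom.commutes]
    simp only [Matrix.algebraMap_matrix_apply]
    simp
  | ι c =>
    have h := cobarMatrix_bracket X c
    rw [bracket] at h
    simp [h]
  | mul a b ha hb =>
    simp [Matrix.mul_apply, ha.1, ha.2.1, ha.2.2, hb.1, hb.2.1, hb.2.2]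
  | add a b ha hb =>
    simp [ha.1, ha.2.1, ha.2.2, hb.1, hb.2.1, hb.2.2]

theorem cobarD_bracket (X : SSet.{u}) (c : RedChains X) :
    cobarD X (bracket X c) = cobarDGen X c := by
  simp [cobarD, cobarMatrix_bracket]

theorem cobarD_mul (X : SSet.{u}) (u v : Cobar X) :
    cobarD X (u * v) = cobarD X u * v + cobarSign X u * cobarD X v := by
  simp [cobarD, Matrix.mul_apply, (cobarMatrix_entries X u).1, (cobarMatrix_entries X v).2.2,
    add_comm]

theorem cobarD_one (X : SSet.{u}) : cobarD X 1 = 0 := by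
  simp [cobarD]

/-- `∂[σ] = -[δσ] + ∑ₚ (-1) ^ p [ₚσ | σ_{n-p}]`. -/
theorem cobarD_gen (X : SSet.{u}) {n : ℕ} (σ : X _⦋n⦌) :
    cobarD X (gen X σ) = -bracket X (redBoundary X (redSimplex X σ)) +
      ∑ p : Fin (n + 1), (-1 : ℤ) ^ (p : ℕ) • (gen X (frontFace X σ p) * gen X (backFace X σ p)) := by
  rw [gen, cobarD_bracket]
  simp only [cobarDGen_apply, LinearMap.comp_apply,
    redComul_redSimplex, map_sum, TensorProduct.map_tmul, redSign_redSimplex, map_smul,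
    LinearMap.mul'_apply, smul_mul_assoc, gen]

/-- The degree `n` part of the cobar construction: it is spanned by the monomials
`[σ₁ | … | σᵣ]` with `∑ (dim σᵢ - 1) = n`, where all `σᵢ` are of positive dimension. -/
def cobarDegree (X : SSet.{u}) (n : ℕ) : Submodule ℤ (Cobar X) :=
  Submodule.span ℤ {w | ∃ l : List (Σ m : ℕ, X _⦋m + 1⦌),
    (l.map fun s => s.1).sum = n ∧ (l.map fun s => gen X s.2).prod = w}

theorem mul_mem_cobarDegree (X : SSet.{u}) {m n : ℕ} {u v : Cobar X}
    (hu : u ∈ cobarDegree X m) (hv : v ∈ cobarDegree X n) : u * v ∈ cobarDegree X (m + n) := by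
  have h : cobarDegree X m * cobarDegree X n ≤ cobarDegree X (m + n) := by
    unfold cobarDegree
    rw [Submodule.span_mul_span]
    refine Submodule.span_mono ?_
    rintro _ ⟨_, ⟨l, hl, rfl⟩, _, ⟨l', hl', rfl⟩, rfl⟩
    exact ⟨l ++ l', by simp [hl, hl'], by simp⟩
  exact h (Submodule.mul_mem_mul hu hv)

theorem one_mem_cobarDegree (X : SSet.{u}) : (1 : Cobar X) ∈ cobarDegree X 0 :=
  Submodule.subset_span ⟨[], by simp, by simp⟩

theorem gen_mem_cobarDegree (X : SSet.{u}) {n : ℕ} (σ : X _⦋n + 1⦌) :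
    gen X σ ∈ cobarDegree X n :=
  Submodule.subset_span ⟨[⟨n, σ⟩], by simp, by simp⟩

theorem cobarSign_of_mem (X : SSet.{u}) {n : ℕ} {u : Cobar X} (hu : u ∈ cobarDegree X n) :
    cobarSign X u = (-1 : ℤ) ^ n • u := by
  induction hu using Submodule.span_induction with
  | mem w hw =>
    obtain ⟨l, rfl, rfl⟩ := hw
    induction l with
    | nil => simp
    | cons s l ih =>
      have hs : cobarSign X (gen X s.2) = (-1 : ℤ) ^ s.1 • gen X s.2 := by
        have : cobarSign X (gen X s.2) = -bracket X (redSign X (redSimplex X s.2)) := by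
          simp [cobarSign, gen, bracket]
        rw [this, redSign_redSimplex, map_smul, pow_succ]
        simp [gen]
      simp only [List.map_cons, List.prod_cons, List.sum_cons, map_mul, hs, ih, pow_add,
        smul_mul_smul_comm]
  | zero => simp
  | add u v _ _ hu hv => rw [map_add, hu, hv, smul_add]
  | smul r u _ hu => rw [map_smul, hu, smul_comm]

/-! ### Truncation at tensor length `k` -/

/-- The ideal `(T^k(s⁻¹ C̄)) = ⨁_{r ≥ k} T^r(s⁻¹ C̄)` generated by the tensors of length `k`. -/
def lengthIdeal (X : SSet.{u}) (k : ℕ) : Ideal (Cobar X) :=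
  Ideal.span (LinearMap.range (bracket X) ^ k : Submodule ℤ (Cobar X))

theorem mul_bracket_mem (X : SSet.{u}) (k : ℕ) {u : Cobar X} (hu : u ∈ lengthIdeal X k)
    (c : RedChains X) : u * bracket X c ∈ lengthIdeal X k := by
  induction hu using Submodule.span_induction with
  | mem t ht =>
    have h : t * bracket X c ∈ LinearMap.range (bracket X) * LinearMap.range (bracket X) ^ k := by
      rw [← pow_succ', pow_succ]
      exact Submodule.mul_mem_mul ht ⟨c, rfl⟩
    exact Submodule.mul_induction_on h
      (fun m _ n hn => Ideal.mul_mem_left _ _ (Ideal.subset_span hn))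
      (fun x y hx hy => add_mem hx hy)
  | zero => simp
  | add u v _ _ hu hv => rw [add_mul]; exact add_mem hu hv
  | smul a u _ hu => rw [smul_eq_mul, mul_assoc]; exact Ideal.mul_mem_left _ _ hu

instance (X : SSet.{u}) (k : ℕ) : (lengthIdeal X k).IsTwoSided where
  mul_mem_of_left {u} b hu := by
    induction b using TensorAlgebra.induction generalizing u with
    | algebraMap r =>
      rw [← Algebra.commutes]
      exact Ideal.mul_mem_left _ _ hu
    | ι c => exact mul_bracket_mem X k hu c
    | mul a b ha hb => rw [← mul_assoc]; exact hb (ha hu)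
    | add a b ha hb => rw [mul_add]; exact add_mem (ha hu) (hb hu)

theorem bracket_mem_lengthIdeal (X : SSet.{u}) (c : RedChains X) :
    bracket X c ∈ lengthIdeal X 1 :=
  Ideal.subset_span (by simp)

theorem mul_mem_lengthIdeal (X : SSet.{u}) (k : ℕ) {u t : Cobar X} (hu : u ∈ lengthIdeal X 1)
    (ht : t ∈ LinearMap.range (bracket X) ^ k) : u * t ∈ lengthIdeal X (k + 1) := by
  induction hu using Submodule.span_induction with
  | mem s hs =>
    refine Ideal.subset_span ?_
    rw [pow_one] at hs
    rw [pow_succ']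
    exact Submodule.mul_mem_mul hs ht
  | zero => simp
  | add u v _ _ hu hv => rw [add_mul]; exact add_mem hu hv
  | smul a u _ hu => rw [smul_eq_mul, mul_assoc]; exact Ideal.mul_mem_left _ _ hu

theorem bracket_mul_mem_lengthIdeal (X : SSet.{u}) (k : ℕ) (c : RedChains X) {u : Cobar X}
    (hu : u ∈ lengthIdeal X k) : bracket X c * u ∈ lengthIdeal X (k + 1) := by
  have key : ∀ v ∈ lengthIdeal X 1, v * u ∈ lengthIdeal X (k + 1) := by
    induction hu using Submodule.span_induction with
    | mem t ht => exact fun v hv => mul_mem_lengthIdeal X k hv ht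
    | zero => simp
    | add u v _ _ hu hv => exact fun w hw => by rw [mul_add]; exact add_mem (hu w hw) (hv w hw)
    | smul a u _ hu =>
      exact fun w hw => by
        rw [smul_eq_mul, ← mul_assoc]
        exact hu _ (Ideal.mul_mem_right _ _ hw)
  exact key _ (bracket_mem_lengthIdeal X c)

theorem cobarDGen_mem_lengthIdeal (X : SSet.{u}) (c : RedChains X) :
    cobarDGen X c ∈ lengthIdeal X 1 := by
  have h : ∀ t : RedChains X ⊗[ℤ] RedChains X, LinearMap.mul' ℤ (Cobar X)
      (TensorProduct.map (bracket X ∘ₗ redSign X) (bracket X) t) ∈ lengthIdeal X 1 := by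
    intro t
    induction t using TensorProduct.induction_on with
    | zero => simp
    | tmul a b =>
      simp only [TensorProduct.map_tmul, LinearMap.mul'_apply]
      exact Ideal.mul_mem_left _ _ (bracket_mem_lengthIdeal X b)
    | add s t hs ht => simp only [map_add]; exact add_mem hs ht
  exact add_mem (neg_mem (bracket_mem_lengthIdeal X _)) (h _)

theorem cobarD_mem_lengthIdeal (X : SSet.{u}) (k : ℕ) {u : Cobar X} (hu : u ∈ lengthIdeal X k) :
    cobarD X u ∈ lengthIdeal X k := by
  have key : ∀ t ∈ LinearMap.range (bracket X) ^ k, cobarD X t ∈ lengthIdeal X k := by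
    clear hu u
    induction k with
    | zero =>
      intro t _
      have h : (1 : Cobar X) ∈ lengthIdeal X 0 := by
        refine Ideal.subset_span ?_
        rw [pow_zero]
        exact Submodule.one_le.1 le_rfl
      simpa using Ideal.mul_mem_left _ (cobarD X t) h
    | succ k ih =>
      intro t ht
      rw [pow_succ'] at ht
      induction ht using Submodule.mul_induction_on' with
      | mem_mul_mem m hm n hn =>
        obtain ⟨c, rfl⟩ := hm
        rw [cobarD_mul, cobarD_bracket]
        refine add_mem (mul_mem_lengthIdeal X k (cobarDGen_mem_lengthIdeal X c) hn) ?_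
        have hc : cobarSign X (bracket X c) = bracket X (-redSign X c) := by
          simp [cobarSign, bracket]
        rw [hc]
        exact bracket_mul_mem_lengthIdeal X k _ (ih n hn)
      | add x _ y _ hx hy => rw [map_add]; exact add_mem hx hy
  induction hu using Submodule.span_induction with
  | mem t ht => exact key t ht
  | zero => simp
  | add u v _ _ hu hv => rw [map_add]; exact add_mem hu hv
  | smul a u hu' hu =>
    rw [smul_eq_mul, cobarD_mul]
    exact add_mem (Ideal.mul_mem_left _ _ hu') (Ideal.mul_mem_left _ _ hu)

/-- The truncated cobar construction `F^(k) = T(s⁻¹ C̄) / (T^k(s⁻¹ C̄))`. -/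
abbrev TruncCobar (X : SSet.{u}) (k : ℕ) : Type u := Cobar X ⧸ lengthIdeal X k

/-- The projection onto the truncated cobar construction. -/
def toTrunc (X : SSet.{u}) (k : ℕ) : Cobar X →+* TruncCobar X k :=
  Ideal.Quotient.mk (lengthIdeal X k)

/-- The differential of the truncated cobar construction. -/
def truncD (X : SSet.{u}) (k : ℕ) : TruncCobar X k →+ TruncCobar X k :=
  QuotientAddGroup.lift (lengthIdeal X k).toAddSubgroup
    ((toTrunc X k).toAddMonoidHom.comp (cobarD X).toAddMonoidHom)
    (fun _ hu => Ideal.Quotient.eq_zero_iff_mem.2 (cobarD_mem_lengthIdeal X k hu))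

theorem truncD_toTrunc (X : SSet.{u}) (k : ℕ) (u : Cobar X) :
    truncD X k (toTrunc X k u) = toTrunc X k (cobarD X u) := rfl

/-- The degree `n` part of the truncated cobar construction. -/
def truncDegree (X : SSet.{u}) (k n : ℕ) : AddSubgroup (TruncCobar X k) :=
  (cobarDegree X n).toAddSubgroup.map (toTrunc X k).toAddMonoidHom

theorem toTrunc_mem (X : SSet.{u}) (k : ℕ) {n : ℕ} {u : Cobar X} (hu : u ∈ cobarDegree X n) :
    toTrunc X k u ∈ truncDegree X k n := ⟨u, hu, rfl⟩

/-! ### Homology in degree `0` -/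

theorem truncD_mul_of_degree_zero (X : SSet.{u}) (k : ℕ) {z w : TruncCobar X k}
    (hz : z ∈ truncDegree X k 0) :
    truncD X k (z * w) = truncD X k z * w + z * truncD X k w := by
  obtain ⟨u, hu, rfl⟩ := hz
  obtain ⟨v, rfl⟩ := Ideal.Quotient.mk_surjective w
  change truncD X k (toTrunc X k u * toTrunc X k v) =
    truncD X k (toTrunc X k u) * toTrunc X k v + toTrunc X k u * truncD X k (toTrunc X k v)
  rw [← map_mul, truncD_toTrunc, truncD_toTrunc, truncD_toTrunc, cobarD_mul, cobarSign_of_mem X hu]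
  simp

theorem truncD_mul_cycle (X : SSet.{u}) (k : ℕ) {z w : TruncCobar X k}
    (hw : truncD X k w = 0) : truncD X k (z * w) = truncD X k z * w := by
  obtain ⟨u, rfl⟩ := Ideal.Quotient.mk_surjective z
  obtain ⟨v, rfl⟩ := Ideal.Quotient.mk_surjective w
  change truncD X k (toTrunc X k v) = 0 at hw
  change truncD X k (toTrunc X k u * toTrunc X k v) = truncD X k (toTrunc X k u) * toTrunc X k v
  rw [truncD_toTrunc] at hw
  rw [← map_mul, truncD_toTrunc, truncD_toTrunc, cobarD_mul, map_add, map_mul, map_mul, hw,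
    mul_zero, add_zero]

theorem mul_mem_truncDegree (X : SSet.{u}) (k : ℕ) {m n : ℕ} {z w : TruncCobar X k}
    (hz : z ∈ truncDegree X k m) (hw : w ∈ truncDegree X k n) :
    z * w ∈ truncDegree X k (m + n) := by
  obtain ⟨u, hu, rfl⟩ := hz
  obtain ⟨v, hv, rfl⟩ := hw
  exact ⟨u * v, mul_mem_cobarDegree X hu hv, map_mul (toTrunc X k) u v⟩

theorem one_mem_truncDegree (X : SSet.{u}) (k : ℕ) :
    (1 : TruncCobar X k) ∈ truncDegree X k 0 := by
  have h := toTrunc_mem X k (one_mem_cobarDegree X)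
  rwa [map_one] at h

theorem truncD_one (X : SSet.{u}) (k : ℕ) : truncD X k 1 = 0 := by
  have h := truncD_toTrunc X k 1
  rwa [map_one, cobarD_one, map_zero] at h

/-- The ring of `0`-cycles of the truncated cobar construction. -/
def zeroCycles (X : SSet.{u}) (k : ℕ) : Subring (TruncCobar X k) where
  carrier := {z | z ∈ truncDegree X k 0 ∧ truncD X k z = 0}
  mul_mem' {z w} hz hw :=
    ⟨by simpa using mul_mem_truncDegree X k hz.1 hw.1, by
      rw [truncD_mul_of_degree_zero X k hz.1, hz.2, hw.2, zero_mul, mul_zero, add_zero]⟩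
  one_mem' := ⟨one_mem_truncDegree X k, truncD_one X k⟩
  add_mem' hz hw := ⟨add_mem hz.1 hw.1, by rw [map_add, hz.2, hw.2, add_zero]⟩
  zero_mem' := ⟨zero_mem _, map_zero _⟩
  neg_mem' hz := ⟨neg_mem hz.1, by rw [map_neg, hz.2, neg_zero]⟩

/-- The two-sided ideal of `0`-boundaries in the ring of `0`-cycles. -/
def zeroBoundaries (X : SSet.{u}) (k : ℕ) : Ideal (zeroCycles X k) where
  carrier := {z | ∃ w ∈ truncDegree X k 1, truncD X k w = z}
  add_mem' := by
    rintro _ _ ⟨w, hw, h⟩ ⟨w', hw', h'⟩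
    exact ⟨w + w', add_mem hw hw', by rw [map_add, h, h']; rfl⟩
  zero_mem' := ⟨0, zero_mem _, map_zero _⟩
  smul_mem' := by
    rintro c _ ⟨w, hw, h⟩
    refine ⟨c * w, by simpa using mul_mem_truncDegree X k c.2.1 hw, ?_⟩
    rw [truncD_mul_of_degree_zero X k c.2.1, c.2.2, zero_mul, zero_add, h]
    rfl

instance (X : SSet.{u}) (k : ℕ) : (zeroBoundaries X k).IsTwoSided where
  mul_mem_of_left := by
    rintro _ c ⟨w, hw, h⟩
    refine ⟨w * c, by simpa using mul_mem_truncDegree X k hw c.2.1, ?_⟩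
    rw [truncD_mul_cycle X k c.2.2, h]
    rfl

/-- The ring `A^(k)(X) = H₀(F^(k))`. -/
abbrev AQuot (X : SSet.{u}) (k : ℕ) : Type u := zeroCycles X k ⧸ zeroBoundaries X k

theorem cobarD_gen_edge (X : SSet.{u}) (a : X _⦋1⦌) : cobarD X (gen X a) = 0 := by
  rw [cobarD_gen, redBoundary_redSimplex]
  simp [Fin.sum_univ_two, gen, redSimplex_zero X rfl (X.δ 0 a), redSimplex_zero X rfl (X.δ 1 a),
    redSimplex_zero X rfl (frontFace X a 0), redSimplex_zero X rfl (backFace X a 1)]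

/-- The `0`-cycle `1 + [a]`, for a `1`-simplex `a`. -/
def oneAddEdge (X : SSet.{u}) (k : ℕ) (a : X _⦋1⦌) : zeroCycles X k :=
  ⟨toTrunc X k (1 + gen X a),
    toTrunc_mem X k (add_mem (one_mem_cobarDegree X) (gen_mem_cobarDegree X a)), by
      rw [truncD_toTrunc, map_add, cobarD_one, cobarD_gen_edge, add_zero, map_zero]⟩

/-- The homology class of a `0`-cycle. -/
def AQuot.mk (X : SSet.{u}) (k : ℕ) (z : zeroCycles X k) : AQuot X k :=
  Ideal.Quotient.mk (zeroBoundaries X k) z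

end CobarPi

end

noncomputable section

namespace CobarPi

/-! ### The universal property of the geometric realization -/

/-! Both rings are generated by one element per edge, subject to one relation per triangle,
truncated at length `k`. In degree `0` the cobar construction is spanned by words in edges, all of
them cycles. For a triangle `t`, `∂[t] = (1 + [d₁t]) - (1 + [d₂t]) (1 + [d₀t])`
(`cobarD_gen_triangle`), so boundaries impose multiplicativity of `a ↦ 1 + [a]` on triangles. Words
of length `k` vanish, hence `1 + [a]` is unipotent and therefore a unit. In the group ring, `I` is
generated by the elements `g_a - 1`, because the `g_a` generate `G`. The assignments `g_a ↦ 1 + [a]`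
and `[a] ↦ g_a - 1` then give mutually inverse ring homomorphisms.

Three facts about `π₁(|X|)` are needed: the triangle relation (`edgeClass_triangle`), generation by
edges (`closure_range_edgeClass`), and the extension of every function on edges that is
multiplicative on triangles to a homomorphism (`exists_hom_of_cocycle`). Together they amount to the
usual edge presentation.

For the extension, a point of a simplex is read as a step function on `[0, 1)` whose intervals have
the barycentric coordinates as lengths. A cocycle `φ` with values in `H` turns this into an
`H`-valued step function, well defined up to left translation. This gives a map from `|X|` to the
quotient of `StepSpace H` by `H`. The projection to this quotient is a covering with group `H`, and
lifting loops produces the homomorphism.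

For generation, let `S` be the subgroup generated by edges. Paths inside simplices define a section
of the set of homotopy classes of paths from the base point, modulo `S`. Every path preserves this
section, by `path_induction`: a path lies in a finite skeleton, and pushing a collar of each top
cell into its boundary cuts it, up to homotopy, into pieces in a lower skeleton and pieces in a
single simplex. This uses the uniqueness of normal forms (`normalForm_unique`), which also comes
from step functions: sampling one along a finite chain recovers a degeneracy of the underlying
nondegenerate simplex. -/

theorem hom_map_apply {X Z : SSet.{u}} (η : X ⟶ Z) {m n : ℕ} (f : ⦋m⦌ ⟶ ⦋n⦌) (σ : X _⦋n⦌) :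
    η.app _ (X.map f.op σ) = Z.map f.op (η.app _ σ) :=
  NatTrans.naturality_apply η f.op σ

theorem simplexMap_map (X : SSet.{u}) {m n : ℕ} (f : ⦋m⦌ ⟶ ⦋n⦌) (σ : X _⦋n⦌)
    (z : stdSimplex ℝ (Fin (m + 1))) :
    simplexMap X (X.map f.op σ) z = simplexMap X σ (stdSimplex.map f z) := by
  have h : (sSetTopAdj.unit.app X).app _ (X.map f.op σ) =
      (TopCat.toSSet.obj |X|).map f.op ((sSetTopAdj.unit.app X).app _ σ) :=
    hom_map_apply (sSetTopAdj.unit.app X) f σ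
  have h' : simplexMap X (X.map f.op σ) = TopCat.toSSetObjEquiv |X| _
      ((TopCat.toSSet.obj |X|).map f.op ((sSetTopAdj.unit.app X).app _ σ)) :=
    congrArg (TopCat.toSSetObjEquiv |X| (Opposite.op ⦋m⦌)) h
  rw [h', simplexMap]
  exact TopCat.toSSetObjEquiv_naturality_apply f _ z

/-- A family of continuous maps on the simplices of `X`, compatible with simplicial operators,
induces a continuous map on the geometric realization. -/
theorem exists_desc (X : SSet.{u}) {T : Type u} [TopologicalSpace T]
    (F : ∀ n : ℕ, X _⦋n⦌ → C(stdSimplex ℝ (Fin (n + 1)), T))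
    (hF : ∀ (m n : ℕ) (f : ⦋m⦌ ⟶ ⦋n⦌) (σ : X _⦋n⦌) (z : stdSimplex ℝ (Fin (m + 1))),
      F m (X.map f.op σ) z = F n σ (stdSimplex.map f z)) :
    ∃ g : C(|X|, T), ∀ (n : ℕ) (σ : X _⦋n⦌) (z : stdSimplex ℝ (Fin (n + 1))),
      g (simplexMap X σ z) = F n σ z := by
  let φ : X ⟶ TopCat.toSSet.obj (TopCat.of T) :=
    { app := fun n => ↾fun σ => (TopCat.toSSetObjEquiv (TopCat.of T) n).symm (F n.unop.len σ)
      naturality := fun n m f => by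
        ext σ
        refine (TopCat.toSSetObjEquiv (TopCat.of T) m).injective ?_
        ext z
        exact hF _ _ f.unop σ z }
  refine ⟨((sSetTopAdj.homEquiv X (TopCat.of T)).symm φ).hom, fun n σ z => ?_⟩
  have h := (sSetTopAdj.homEquiv X (TopCat.of T)).apply_symm_apply φ
  rw [Adjunction.homEquiv_unit] at h
  have h2 : (TopCat.toSSet.map ((sSetTopAdj.homEquiv X (TopCat.of T)).symm φ)).app _
      ((sSetTopAdj.unit.app X).app (Opposite.op ⦋n⦌) σ) = φ.app _ σ := by
    exact congrArg (fun ψ : X ⟶ TopCat.toSSet.obj (TopCat.of T) => ψ.app (Opposite.op ⦋n⦌) σ) h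
  have h3 := congrArg (fun c => TopCat.toSSetObjEquiv (TopCat.of T) (Opposite.op ⦋n⦌) c z) h2
  exact h3

theorem continuousMap_ext (X : SSet.{u}) {T : Type u} [TopologicalSpace T] {g h : C(|X|, T)}
    (H : ∀ (n : ℕ) (σ : X _⦋n⦌) (z : stdSimplex ℝ (Fin (n + 1))),
      g (simplexMap X σ z) = h (simplexMap X σ z)) : g = h := by
  have key : (TopCat.ofHom g : |X| ⟶ TopCat.of T) = TopCat.ofHom h := by
    apply (sSetTopAdj.homEquiv X (TopCat.of T)).injective
    rw [Adjunction.homEquiv_unit, Adjunction.homEquiv_unit]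
    ext n σ
    refine (TopCat.toSSetObjEquiv (TopCat.of T) n).injective ?_
    ext z
    exact H n.unop.len σ z
  exact congrArg TopCat.Hom.hom key

/-- Every point of the geometric realization lies on some simplex. -/
theorem exists_simplexMap_eq (X : SSet.{u}) (y : |X|) :
    ∃ (n : ℕ) (σ : X _⦋n⦌) (z : stdSimplex ℝ (Fin (n + 1))), simplexMap X σ z = y := by
  -- In the indiscrete topology every map is continuous, so the uniqueness statement applies to this
  -- predicate and the constant `True`, which agree on all simplices.
  let P : |X| → ULift.{u} Prop := fun y => ⟨∃ (n : ℕ) (σ : X _⦋n⦌)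
    (z : stdSimplex ℝ (Fin (n + 1))), simplexMap X σ z = y⟩
  let : TopologicalSpace (ULift.{u} Prop) := ⊤
  have h := continuousMap_ext X (g := ⟨P, continuous_top⟩) (h := ⟨fun _ => ⟨True⟩, continuous_top⟩)
    (fun n σ z => by
      change P _ = _
      simp only [P]
      congr 1
      exact eq_true ⟨n, σ, z, rfl⟩)
  have h2 := congrArg ULift.down (DFunLike.congr_fun h y)
  exact of_eq_true h2

/-- The function version of `exists_desc`. -/
theorem exists_fun_desc (X : SSet.{u}) {T : Type u}
    (F : ∀ n : ℕ, X _⦋n⦌ → stdSimplex ℝ (Fin (n + 1)) → T)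
    (hF : ∀ (m n : ℕ) (f : ⦋m⦌ ⟶ ⦋n⦌) (σ : X _⦋n⦌) (z : stdSimplex ℝ (Fin (m + 1))),
      F m (X.map f.op σ) z = F n σ (stdSimplex.map f z)) :
    ∃ g : |X| → T, ∀ (n : ℕ) (σ : X _⦋n⦌) (z : stdSimplex ℝ (Fin (n + 1))),
      g (simplexMap X σ z) = F n σ z := by
  let : TopologicalSpace T := ⊤
  obtain ⟨g, hg⟩ := exists_desc X (T := T) (fun n σ => ⟨F n σ, continuous_top⟩) hF
  exact ⟨g, hg⟩

/-- The geometric realization carries the final topology with respect to its simplices. -/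
theorem isClosed_of_preimage (X : SSet.{u}) {A : Set |X|}
    (hA : ∀ (n : ℕ) (σ : X _⦋n⦌), IsClosed (simplexMap X σ ⁻¹' A)) : IsClosed A := by
  -- With the Sierpiński topology, closed sets are the same as continuous maps to `Prop`, so
  -- finality of the topology is an instance of `exists_desc`. The two versions `hT` and `hT'` serve
  -- `|X|` and the simplices, which live in different universes.
  let T : TopologicalSpace (ULift.{u} Prop) :=
    TopologicalSpace.induced ULift.down inferInstance
  have hT : ∀ {Z : Type u} [TopologicalSpace Z] (C : Set Z),
      IsClosed C ↔ Continuous (fun z => (⟨z ∉ C⟩ : ULift.{u} Prop)) := by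
    intro Z _ C
    rw [continuous_induced_rng]
    exact ⟨fun h => continuous_Prop.2 h.isOpen_compl, fun h => ⟨continuous_Prop.1 h⟩⟩
  have hT' : ∀ {Z : Type} [TopologicalSpace Z] (C : Set Z),
      IsClosed C → Continuous (fun z => (⟨z ∉ C⟩ : ULift.{u} Prop)) := by
    intro Z _ C h
    rw [continuous_induced_rng]
    exact continuous_Prop.2 h.isOpen_compl
  obtain ⟨g, hg⟩ := exists_desc X (T := ULift.{u} Prop)
    (fun n σ => ⟨fun z => ⟨simplexMap X σ z ∉ A⟩, hT' _ (hA n σ)⟩)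
    (fun m n f σ z => by
      change (⟨_⟩ : ULift.{u} Prop) = ⟨_⟩
      rw [simplexMap_map])
  rw [hT]
  convert g.continuous using 1
  ext y
  obtain ⟨n, σ, z, rfl⟩ := exists_simplexMap_eq X y
  rw [hg]
  rfl

/-! ### Points of the standard simplex as step functions -/

theorem sum_stdSimplex_map {α β : Type*} [Fintype α] [Fintype β] [DecidableEq β] (f : α → β)
    (v : stdSimplex ℝ α) (s : Finset β) :
    ∑ b ∈ s, stdSimplex.map f v b = ∑ a with f a ∈ s, v a := by
  have h : ∀ b, stdSimplex.map f v b = ∑ a with f a = b, v a := fun b => by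
    rw [stdSimplex.map_coe, FunOnFinite.linearMap_apply_apply]
  simp_rw [h]
  rw [← Finset.sum_fiberwise_of_maps_to (s := {a | f a ∈ s}) (t := s) (g := f) (by simp)]
  refine Finset.sum_congr rfl fun b hb => Finset.sum_congr ?_ fun _ _ => rfl
  ext a
  simp only [Finset.mem_filter, Finset.mem_univ, true_and]
  exact ⟨fun h => ⟨h ▸ hb, h⟩, fun h => h.2⟩

theorem sum_Iic_eq {n : ℕ} (v : stdSimplex ℝ (Fin (n + 1))) (j : Fin (n + 1)) :
    ∑ i ∈ Finset.Iic j, v i = ∑ i ∈ Finset.Iio j, v i + v j := by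
  rw [← Finset.Iio_insert, Finset.sum_insert (by simp), add_comm]

theorem sum_Iio_nonneg {n : ℕ} (v : stdSimplex ℝ (Fin (n + 1))) (j : Fin (n + 1)) :
    0 ≤ ∑ i ∈ Finset.Iio j, v i :=
  Finset.sum_nonneg fun i _ => v.2.1 i

theorem sum_Iic_le_one {n : ℕ} (v : stdSimplex ℝ (Fin (n + 1))) (j : Fin (n + 1)) :
    ∑ i ∈ Finset.Iic j, v i ≤ 1 := by
  rw [← stdSimplex.sum_eq_one v]
  exact Finset.sum_le_sum_of_subset_of_nonneg (Finset.subset_univ _) fun i _ _ => v.2.1 i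

theorem sum_Iic_le_sum_Iio {n : ℕ} (v : stdSimplex ℝ (Fin (n + 1))) {i j : Fin (n + 1)}
    (h : i < j) : ∑ l ∈ Finset.Iic i, v l ≤ ∑ l ∈ Finset.Iio j, v l := by
  refine Finset.sum_le_sum_of_subset_of_nonneg (fun l hl => ?_) fun i _ _ => v.2.1 i
  rw [Finset.mem_Iic] at hl
  exact Finset.mem_Iio.2 (hl.trans_lt h)

/-- The index is the first one whose cumulative weight exceeds `r`; one exists because the total
weight is `1` and `r < 1`. -/
theorem exists_step {n : ℕ} (v : stdSimplex ℝ (Fin (n + 1))) (r : Set.Ico (0 : ℝ) 1) :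
    ∃ j : Fin (n + 1), ∑ i ∈ Finset.Iio j, v i ≤ r ∧ (r : ℝ) < ∑ i ∈ Finset.Iic j, v i := by
  let S : Set (Fin (n + 1)) := {j | (r : ℝ) < ∑ i ∈ Finset.Iic j, v i}
  have hne : S.Nonempty := by
    refine ⟨Fin.last n, ?_⟩
    have h : Finset.Iic (Fin.last n) = Finset.univ := by
      ext i; simp [Fin.le_last]
    change (r : ℝ) < _
    rw [h, stdSimplex.sum_eq_one]
    exact r.2.2
  let j := wellFounded_lt.min _ hne
  have hj : (r : ℝ) < ∑ i ∈ Finset.Iic j, v i := wellFounded_lt.min_mem _ hne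
  refine ⟨j, ?_, hj⟩
  obtain h0 | ⟨i, hi⟩ := Fin.eq_zero_or_eq_succ j
  · rw [h0]
    have h : Finset.Iio (0 : Fin (n + 1)) = ∅ := by ext i; simp
    rw [h, Finset.sum_empty]
    exact r.2.1
  · have h : Finset.Iio j = Finset.Iic i.castSucc := by
      ext l
      rw [Finset.mem_Iio, Finset.mem_Iic, hi, Fin.lt_def, Fin.le_def, Fin.val_succ,
        Fin.val_castSucc]
      omega
    rw [h]
    by_contra hlt
    have hS : i.castSucc ∈ S := not_le.1 hlt
    refine wellFounded_lt.not_lt_min S hS ?_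
    change i.castSucc < j
    rw [hi]
    exact Fin.castSucc_lt_succ

/-- The step function with values `0, 1, …, n` on consecutive intervals of lengths
`v 0, v 1, …, v n`. -/
def stepFn {n : ℕ} (v : stdSimplex ℝ (Fin (n + 1))) (r : Set.Ico (0 : ℝ) 1) : Fin (n + 1) :=
  (exists_step v r).choose

theorem stepFn_le_iff {n : ℕ} (v : stdSimplex ℝ (Fin (n + 1))) (r : Set.Ico (0 : ℝ) 1)
    (j : Fin (n + 1)) : stepFn v r ≤ j ↔ (r : ℝ) < ∑ i ∈ Finset.Iic j, v i := by
  obtain ⟨h1, h2⟩ := (exists_step v r).choose_spec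
  refine ⟨fun h => h2.trans_le ?_, fun h => ?_⟩
  · exact Finset.sum_le_sum_of_subset_of_nonneg (Finset.Iic_subset_Iic.2 h) fun i _ _ => v.2.1 i
  · by_contra hlt
    exact absurd (h.trans_le ((sum_Iic_le_sum_Iio v (not_le.1 hlt)).trans h1)) (lt_irrefl _)

theorem stepFn_lt_iff {n : ℕ} (v : stdSimplex ℝ (Fin (n + 1))) (r : Set.Ico (0 : ℝ) 1)
    (j : Fin (n + 1)) : stepFn v r < j ↔ (r : ℝ) < ∑ i ∈ Finset.Iio j, v i := by
  obtain ⟨h1, h2⟩ := (exists_step v r).choose_spec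
  refine ⟨fun h => h2.trans_le (sum_Iic_le_sum_Iio v h), fun h => ?_⟩
  by_contra hlt
  refine absurd (h.trans_le (le_trans ?_ h1)) (lt_irrefl _)
  exact Finset.sum_le_sum_of_subset_of_nonneg (Finset.Iio_subset_Iio (not_lt.1 hlt))
    fun i _ _ => v.2.1 i

theorem stepFn_eq_iff {n : ℕ} (v : stdSimplex ℝ (Fin (n + 1))) (r : Set.Ico (0 : ℝ) 1)
    (j : Fin (n + 1)) : stepFn v r = j ↔
      ∑ i ∈ Finset.Iio j, v i ≤ r ∧ (r : ℝ) < ∑ i ∈ Finset.Iic j, v i := by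
  rw [← stepFn_le_iff, ← not_lt, ← stepFn_lt_iff, not_lt, and_comm, le_antisymm_iff]

/-- A monotone map merges consecutive intervals or inserts empty ones without reordering them, so
only the values change. This naturality in simplicial operators lets constructions with step
functions descend to `|X|`. -/
theorem stepFn_map {m n : ℕ} (f : Fin (m + 1) →o Fin (n + 1)) (v : stdSimplex ℝ (Fin (m + 1)))
    (r : Set.Ico (0 : ℝ) 1) : stepFn (stdSimplex.map f v) r = f (stepFn v r) := by
  obtain ⟨h1, h2⟩ := (stepFn_eq_iff v r _).1 rfl
  rw [stepFn_eq_iff, sum_stdSimplex_map, sum_stdSimplex_map]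
  constructor
  · refine le_trans (Finset.sum_le_sum_of_subset_of_nonneg (fun i hi => ?_) fun i _ _ => v.2.1 i) h1
    simp only [Finset.mem_Iio, Finset.mem_filter, Finset.mem_univ, true_and] at hi ⊢
    exact lt_of_not_ge fun h => absurd hi (not_lt.2 (f.monotone h))
  · refine lt_of_lt_of_le h2
      (Finset.sum_le_sum_of_subset_of_nonneg (fun i hi => ?_) fun i _ _ => v.2.1 i)
    simp only [Finset.mem_Iic, Finset.mem_filter, Finset.mem_univ, true_and] at hi ⊢
    exact f.monotone hi

theorem stepFn_monotone {n : ℕ} (v : stdSimplex ℝ (Fin (n + 1))) : Monotone (stepFn v) :=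
  fun r s hrs => (stepFn_le_iff v r _).2 (lt_of_le_of_lt hrs ((stepFn_le_iff v s _).1 le_rfl))

theorem stepFn_surjective {n : ℕ} {v : stdSimplex ℝ (Fin (n + 1))} (hv : ∀ i, 0 < v i) :
    Function.Surjective (stepFn v) := fun j => by
  have h := sum_Iic_eq v j
  refine ⟨⟨∑ i ∈ Finset.Iio j, v i, sum_Iio_nonneg v j, ?_⟩, (stepFn_eq_iff v _ j).2 ⟨le_rfl, ?_⟩⟩
  · linarith [hv j, sum_Iic_le_one v j]
  · simp only
    linarith [hv j]

/-- The cumulative weights are the jump positions. If two of them differed, the step functions would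
differ at the smaller one. -/
theorem stepFn_injective {n : ℕ} :
    Function.Injective (stepFn (n := n)) := by
  have h1 : ∀ (v w : stdSimplex ℝ (Fin (n + 1))) (j : Fin (n + 1)), stepFn v = stepFn w →
      ∑ i ∈ Finset.Iic j, v i ≤ ∑ i ∈ Finset.Iic j, w i := fun v w j h => by
    by_contra hlt
    rw [not_le] at hlt
    let r : Set.Ico (0 : ℝ) 1 := ⟨∑ i ∈ Finset.Iic j, w i,
      Finset.sum_nonneg fun i _ => w.2.1 i, hlt.trans_le (sum_Iic_le_one v j)⟩
    have hr := (stepFn_le_iff v r j).2 hlt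
    rw [h, stepFn_le_iff] at hr
    exact lt_irrefl _ hr
  have h2 : ∀ (v w : stdSimplex ℝ (Fin (n + 1))) (j : Fin (n + 1)), stepFn v = stepFn w →
      ∑ i ∈ Finset.Iio j, v i ≤ ∑ i ∈ Finset.Iio j, w i := fun v w j h => by
    by_contra hlt
    rw [not_le] at hlt
    let r : Set.Ico (0 : ℝ) 1 := ⟨∑ i ∈ Finset.Iio j, w i,
      Finset.sum_nonneg fun i _ => w.2.1 i, hlt.trans_le (by
        linarith [sum_Iic_le_one v j, sum_Iic_eq v j, v.2.1 j, stdSimplex.zero_le v j])⟩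
    have hr := (stepFn_lt_iff v r j).2 hlt
    rw [h, stepFn_lt_iff] at hr
    exact lt_irrefl _ hr
  intro v w h
  refine stdSimplex.ext (funext fun j => ?_)
  have e1 := le_antisymm (h1 v w j h) (h1 w v j h.symm)
  have e2 := le_antisymm (h2 v w j h) (h2 w v j h.symm)
  rw [sum_Iic_eq, sum_Iic_eq, e2] at e1
  exact add_left_cancel e1

/-! ### Normal forms of points in the geometric realization -/

/-- The morphism of the simplex category given by evaluating a step function along a chain. -/
def sampleHom {n k : ℕ} (v : stdSimplex ℝ (Fin (n + 1))) (A : Fin (k + 1) →o Set.Ico (0 : ℝ) 1) :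
    ⦋k⦌ ⟶ ⦋n⦌ :=
  SimplexCategory.mkHom ((⟨stepFn v, stepFn_monotone v⟩ : Set.Ico (0 : ℝ) 1 →o _).comp A)

theorem sampleHom_apply {n k : ℕ} (v : stdSimplex ℝ (Fin (n + 1)))
    (A : Fin (k + 1) →o Set.Ico (0 : ℝ) 1) (i : Fin (k + 1)) :
    sampleHom v A i = stepFn v (A i) := rfl

theorem sampleHom_map {m n k : ℕ} (f : ⦋m⦌ ⟶ ⦋n⦌) (v : stdSimplex ℝ (Fin (m + 1)))
    (A : Fin (k + 1) →o Set.Ico (0 : ℝ) 1) :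
    sampleHom (stdSimplex.map f v) A = sampleHom v A ≫ f := by
  ext i : 3
  exact stepFn_map f.toOrderHom v (A i)

/-- For a fixed chain of sample points, the sampled simplex is compatible with simplicial operators,
hence a function on `|X|`. -/
theorem map_sampleHom_eq (X : SSet.{u}) {m n : ℕ} {σ : X _⦋m⦌} {τ : X _⦋n⦌}
    {v : stdSimplex ℝ (Fin (m + 1))} {w : stdSimplex ℝ (Fin (n + 1))}
    (h : simplexMap X σ v = simplexMap X τ w) {k : ℕ} (A : Fin (k + 1) →o Set.Ico (0 : ℝ) 1) :
    X.map (sampleHom v A).op σ = X.map (sampleHom w A).op τ := by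
  obtain ⟨g, hg⟩ := exists_fun_desc X (T := X _⦋k⦌) (fun n σ v => X.map (sampleHom v A).op σ)
    (fun m n f σ z => by
      rw [sampleHom_map, op_comp, Functor.map_comp, comp_apply])
  rw [← hg, ← hg, h]

/-- A point lies in the interior of at most one nondegenerate simplex, and has unique coordinates
there. -/
theorem normalForm_unique (X : SSet.{u}) {m n : ℕ} {σ : X _⦋m⦌} {τ : X _⦋n⦌}
    (hσ : σ ∈ X.nonDegenerate m) (hτ : τ ∈ X.nonDegenerate n)
    {v : stdSimplex ℝ (Fin (m + 1))} {w : stdSimplex ℝ (Fin (n + 1))}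
    (hv : ∀ i, 0 < v i) (hw : ∀ i, 0 < w i)
    (h : simplexMap X σ v = simplexMap X τ w) :
    (⟨m, σ, v⟩ : Σ n : ℕ, X _⦋n⦌ × stdSimplex ℝ (Fin (n + 1))) = ⟨n, τ, w⟩ := by
  choose a ha using stepFn_surjective hv
  choose b hb using stepFn_surjective hw
  -- The chain contains a point where each value of each of the two step functions is attained, so
  -- both sampling maps are epimorphisms. It also contains an arbitrary `r`, at which the step
  -- functions will be compared.
  have key : ∀ r : Set.Ico (0 : ℝ) 1, ∃ (k : ℕ) (A : Fin (k + 1) →o Set.Ico (0 : ℝ) 1),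
      (∃ i, A i = r) ∧ (∀ j, ∃ i, A i = a j) ∧ ∀ j, ∃ i, A i = b j := fun r => by
    classical
    let B : Finset (Set.Ico (0 : ℝ) 1) :=
      insert r (Finset.univ.image a ∪ Finset.univ.image b)
    have hB : B.card = (B.card - 1) + 1 :=
      (Nat.succ_pred_eq_of_pos (Finset.card_pos.2 ⟨r, by simp [B]⟩)).symm
    refine ⟨B.card - 1, (B.orderEmbOfFin hB).toOrderHom, ?_⟩
    have hr : ∀ s ∈ B, ∃ i, B.orderEmbOfFin hB i = s := fun s hs => by
      have := B.range_orderEmbOfFin hB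
      rw [← Finset.mem_coe, ← this] at hs
      exact hs
    exact ⟨hr r (by simp [B]), fun j => hr _ (by simp [B]), fun j => hr _ (by simp [B])⟩
  have epi_of : ∀ {l k : ℕ} {z : stdSimplex ℝ (Fin (l + 1))} {c : Fin (l + 1) → Set.Ico (0 : ℝ) 1}
      (_ : ∀ j, stepFn z (c j) = j) (A : Fin (k + 1) →o Set.Ico (0 : ℝ) 1),
      (∀ j, ∃ i, A i = c j) → Epi (sampleHom z A) := fun hc A hA => by
    rw [SimplexCategory.epi_iff_surjective]
    intro j
    obtain ⟨i, hi⟩ := hA j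
    exact ⟨i, (sampleHom_apply _ A i).trans (by rw [hi, hc])⟩
  obtain ⟨k₀, A₀, -, hA₀a, hA₀b⟩ := key (a 0)
  -- The sampled simplex is a degeneracy of both `σ` and `τ`. Uniqueness in the Eilenberg–Zilber
  -- lemma identifies the dimensions, the simplices and finally the two epimorphisms, whose values
  -- include those of the step functions at `r`.
  obtain rfl : m = n := by
    have := epi_of ha A₀ hA₀a
    have := epi_of hb A₀ hA₀b
    exact X.unique_nonDegenerate_dim _ (sampleHom v A₀) ⟨σ, hσ⟩ rfl (sampleHom w A₀) ⟨τ, hτ⟩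
      (map_sampleHom_eq X h A₀)
  have hστ : σ = τ := by
    have := epi_of ha A₀ hA₀a
    exact congrArg Subtype.val (X.unique_nonDegenerate_simplex _ (sampleHom v A₀) ⟨σ, hσ⟩ rfl
      (sampleHom w A₀) ⟨τ, hτ⟩ (map_sampleHom_eq X h A₀))
  have hvw : v = w := by
    refine stepFn_injective (funext fun r => ?_)
    obtain ⟨k, A, ⟨i, hi⟩, hAa, -⟩ := key r
    have := epi_of ha A hAa
    have e := X.unique_nonDegenerate_map _ (sampleHom v A) ⟨σ, hσ⟩ rfl
      (sampleHom w A) ⟨τ, hτ⟩ (map_sampleHom_eq X h A)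
    rw [← hi, ← sampleHom_apply, ← sampleHom_apply, e]
  rw [hστ, hvw]

/-! ### Skeleta, closed subsets and compact subsets of the realization -/

/-- The image in `|X|` of the simplices of dimension less than `n`. -/
def skel (X : SSet.{u}) (n : ℕ) : Set |X| :=
  {y | ∃ (m : ℕ) (_ : m < n) (σ : X _⦋m⦌) (v : stdSimplex ℝ (Fin (m + 1))), simplexMap X σ v = y}

theorem simplexMap_mem_skel (X : SSet.{u}) {m n : ℕ} (h : m < n) (σ : X _⦋m⦌)
    (v : stdSimplex ℝ (Fin (m + 1))) : simplexMap X σ v ∈ skel X n := ⟨m, h, σ, v, rfl⟩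

theorem skel_mono (X : SSet.{u}) {m n : ℕ} (h : m ≤ n) : skel X m ⊆ skel X n := by
  rintro _ ⟨l, hl, σ, v, rfl⟩
  exact simplexMap_mem_skel X (hl.trans_le h) σ v

/-- A point of a simplex with a vanishing coordinate lies on a face. -/
theorem exists_map_succAbove {n : ℕ} {v : stdSimplex ℝ (Fin (n + 2))} {i : Fin (n + 2)}
    (hi : v i = 0) : ∃ w : stdSimplex ℝ (Fin (n + 1)), stdSimplex.map i.succAbove w = v := by
  have hsum : ∑ j, v (i.succAbove j) = 1 := by
    rw [← stdSimplex.sum_eq_one v, Fin.sum_univ_succAbove (fun j => v j) i, hi, zero_add]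
  refine ⟨⟨fun j => v (i.succAbove j), fun j => v.2.1 _, hsum⟩, ?_⟩
  refine stdSimplex.ext (funext fun j => ?_)
  rw [stdSimplex.map_coe, FunOnFinite.linearMap_apply_apply]
  obtain rfl | ⟨j, rfl⟩ := Fin.eq_self_or_eq_succAbove i j
  · rw [hi, Finset.sum_eq_zero]
    intro l hl
    exact absurd (Finset.mem_filter.1 hl).2 (Fin.succAbove_ne _ _)
  · have h : (Finset.univ.filter fun l => i.succAbove l = i.succAbove j) = {j} := by
      ext l; simp
    rw [h, Finset.sum_singleton]
    rfl

theorem coord_pos_of_dim_zero (v : stdSimplex ℝ (Fin (0 + 1))) (i : Fin (0 + 1)) : 0 < v i := by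
  have h := stdSimplex.sum_eq_one v
  rw [Fin.sum_univ_one] at h
  rw [Fin.fin_one_eq_zero i, h]
  exact one_pos

theorem mem_skel_of_coord_eq_zero (X : SSet.{u}) {n : ℕ} (σ : X _⦋n⦌)
    {v : stdSimplex ℝ (Fin (n + 1))} {i : Fin (n + 1)} (hi : v i = 0) :
    simplexMap X σ v ∈ skel X n := by
  cases n with
  | zero => exact absurd hi (coord_pos_of_dim_zero v i).ne'
  | succ n =>
    obtain ⟨w, rfl⟩ := exists_map_succAbove hi
    rw [← simplexMap_δ]
    exact simplexMap_mem_skel X (Nat.lt_succ_self n) _ _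

theorem mem_skel_of_degenerate (X : SSet.{u}) {n : ℕ} {σ : X _⦋n⦌} (hσ : σ ∈ X.degenerate n)
    (v : stdSimplex ℝ (Fin (n + 1))) : simplexMap X σ v ∈ skel X n := by
  obtain ⟨m, hm, f, τ, rfl⟩ := hσ
  rw [simplexMap_map]
  exact simplexMap_mem_skel X hm _ _

theorem exists_normalForm_of_mem_skel (X : SSet.{u}) (n : ℕ) {y : |X|} (hy : y ∈ skel X n) :
    ∃ (m : ℕ) (_ : m < n) (σ : X _⦋m⦌) (_ : σ ∈ X.nonDegenerate m)
      (v : stdSimplex ℝ (Fin (m + 1))) (_ : ∀ i, 0 < v i), simplexMap X σ v = y := by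
  induction n with
  | zero =>
    obtain ⟨m, hm, -⟩ := hy
    omega
  | succ n ih =>
    by_cases hn : y ∈ skel X n
    · obtain ⟨m, hm, h⟩ := ih hn
      exact ⟨m, by omega, h⟩
    · obtain ⟨m, hm, σ, v, rfl⟩ := hy
      obtain rfl : m = n := by
        by_contra hne
        exact hn (simplexMap_mem_skel X (by omega) σ v)
      refine ⟨m, hm, σ, fun hσ => hn (mem_skel_of_degenerate X hσ v), v, fun i => ?_, rfl⟩
      exact lt_of_le_of_ne (v.2.1 i) fun h => hn (mem_skel_of_coord_eq_zero X σ h.symm)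

theorem interior_notMem_skel (X : SSet.{u}) {n : ℕ} {σ : X _⦋n⦌} (hσ : σ ∈ X.nonDegenerate n)
    {v : stdSimplex ℝ (Fin (n + 1))} (hv : ∀ i, 0 < v i) : simplexMap X σ v ∉ skel X n := by
  intro h
  obtain ⟨m, hm, τ, hτ, w, hw, e⟩ := exists_normalForm_of_mem_skel X n h
  have := congrArg Sigma.fst (normalForm_unique X hτ hσ hw hv e)
  simp only at this
  omega

theorem exists_mem_skel (X : SSet.{u}) (y : |X|) : ∃ n, y ∈ skel X n := by
  obtain ⟨n, σ, v, rfl⟩ := exists_simplexMap_eq X y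
  exact ⟨n + 1, simplexMap_mem_skel X (Nat.lt_succ_self n) σ v⟩

/-- A subset of `|X|` is closed if its trace on the interior of each nondegenerate simplex is
contained in a closed part of its trace on that simplex. -/
theorem isClosed_of_nonDegenerate (X : SSet.{u}) {A : Set |X|}
    (hA : ∀ (n : ℕ) (σ : X _⦋n⦌), σ ∈ X.nonDegenerate n →
      ∃ B : Set (stdSimplex ℝ (Fin (n + 1))), IsClosed B ∧ B ⊆ simplexMap X σ ⁻¹' A ∧
        ∀ v, (∀ i, 0 < v i) → simplexMap X σ v ∈ A → v ∈ B) : IsClosed A := by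
  refine isClosed_of_preimage X fun n => ?_
  induction n using Nat.strong_induction_on with
  | _ n ih =>
  intro σ
  by_cases hσ : σ ∈ X.nonDegenerate n
  · obtain ⟨B, hB, hBA, hAB⟩ := hA n σ hσ
    cases n with
    | zero =>
      convert hB using 1
      exact Set.Subset.antisymm (fun v hv => hAB v (coord_pos_of_dim_zero v) hv) hBA
    | succ n =>
      -- The part of the trace not in `B` lies on the boundary, where it is a finite union of images
      -- of compact sets supplied by induction.
      have h : simplexMap X σ ⁻¹' A = B ∪ ⋃ i : Fin (n + 2),
          stdSimplex.map i.succAbove '' (simplexMap X (X.δ i σ) ⁻¹' A) := by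
        ext v
        simp only [Set.mem_preimage, Set.mem_union, Set.mem_iUnion, Set.mem_image]
        constructor
        · intro hv
          by_cases hpos : ∀ i, 0 < v i
          · exact Or.inl (hAB v hpos hv)
          · push Not at hpos
            obtain ⟨i, hi⟩ := hpos
            obtain ⟨w, rfl⟩ := exists_map_succAbove (le_antisymm hi (v.2.1 i))
            exact Or.inr ⟨i, w, by rwa [simplexMap_δ], rfl⟩
        · rintro (hv | ⟨i, w, hw, rfl⟩)
          · exact hBA hv
          · rwa [simplexMap_δ] at hw
      rw [h]
      refine hB.union (isClosed_iUnion_of_finite fun i => ?_)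
      exact ((ih n (Nat.lt_succ_self n) (X.δ i σ)).isCompact.image
        (stdSimplex.continuous_map _)).isClosed
  · rw [← SSet.mem_degenerate_iff_notMem_nonDegenerate] at hσ
    obtain ⟨m, hm, f, τ, rfl⟩ := hσ
    have h : simplexMap X (X.map f.op τ) ⁻¹' A =
        stdSimplex.map f ⁻¹' (simplexMap X τ ⁻¹' A) := by
      ext v
      simp only [Set.mem_preimage, simplexMap_map]
    rw [h]
    exact (ih m hm τ).preimage (stdSimplex.continuous_map _)

/-- A subset of the skeleton is closed if its traces on the nondegenerate simplices of the skeleton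
are closed. -/
theorem isClosed_of_subset_skel (X : SSet.{u}) {n : ℕ} {A : Set |X|} (hn : A ⊆ skel X n)
    (hA : ∀ m < n, ∀ σ : X _⦋m⦌, σ ∈ X.nonDegenerate m → IsClosed (simplexMap X σ ⁻¹' A)) :
    IsClosed A := by
  refine isClosed_of_nonDegenerate X fun m σ hσ => ?_
  by_cases h : m < n
  · exact ⟨_, hA m h σ hσ, subset_rfl, fun _ _ hv => hv⟩
  · refine ⟨∅, isClosed_empty, Set.empty_subset _, fun v hv hvA => ?_⟩
    exact absurd (skel_mono X (not_lt.1 h) (hn hvA)) (interior_notMem_skel X hσ hv)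

/-- A compact subset of `|X|` is contained in a skeleton. -/
theorem exists_subset_skel_of_isCompact (X : SSet.{u}) {K : Set |X|} (hK : IsCompact K) :
    ∃ n, K ⊆ skel X n := by
  by_contra! hcon
  have hex : ∀ n, ∃ y ∈ K, y ∉ skel X n := fun n => Set.not_subset.1 (hcon n)
  choose y hyK hy using hex
  have hfin : ∀ n, (Set.range y ∩ skel X n).Finite := fun n => by
    refine ((Set.finite_lt_nat n).image y).subset ?_
    rintro _ ⟨⟨m, rfl⟩, hm⟩
    exact ⟨m, lt_of_not_ge fun h => hy m (skel_mono X h hm), rfl⟩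
  -- Only the `y m` with `m ≤ n` can lie on an `n`-simplex, so `T` meets each open cell in finitely
  -- many points. All subsets of the sequence being closed, its range is compact and discrete, hence
  -- finite, hence in one skeleton.
  have hcl : ∀ T ⊆ Set.range y, IsClosed T := fun T hT => by
    refine isClosed_of_nonDegenerate X fun n σ hσ => ?_
    refine ⟨{v | (∀ i, 0 < v i) ∧ simplexMap X σ v ∈ T}, Set.Finite.isClosed ?_,
      fun v hv => hv.2, fun v hv hvT => ⟨hv, hvT⟩⟩
    refine Set.Finite.of_finite_image (f := simplexMap X σ) ((hfin (n + 1)).subset ?_) ?_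
    · rintro _ ⟨v, hv, rfl⟩
      exact ⟨hT hv.2, simplexMap_mem_skel X (Nat.lt_succ_self n) σ v⟩
    · intro v hv w hw e
      have := normalForm_unique X hσ hσ hv.1 hw.1 e
      simpa using this
  have hdisc : DiscreteTopology (Set.range y) := by
    rw [discreteTopology_iff_forall_isClosed]
    intro s
    have : s = Subtype.val ⁻¹' (Subtype.val '' s) :=
      (Set.preimage_image_eq s Subtype.val_injective).symm
    rw [this]
    exact (hcl _ (by rintro _ ⟨a, -, rfl⟩; exact a.2)).preimage continuous_subtype_val
  have hcomp : IsCompact (Set.range y) :=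
    hK.of_isClosed_subset (hcl _ subset_rfl) (by rintro _ ⟨n, rfl⟩; exact hyK n)
  have hfinite : (Set.range y).Finite := hcomp.finite (isDiscrete_iff_discreteTopology.2 hdisc)
  have hb : ∃ N, ∀ z ∈ Set.range y, z ∈ skel X N := by
    choose N hN using exists_mem_skel X
    obtain ⟨M, hM⟩ := (hfinite.image N).bddAbove
    exact ⟨M, fun z hz => skel_mono X (hM ⟨z, hz, rfl⟩) (hN z)⟩
  obtain ⟨N, hN⟩ := hb
  exact hy N (hN _ ⟨N, rfl⟩)

/-! ### The space of functions `[0, 1) → H` and its quotient by `H` -/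

/-- The space of functions `[0, 1) → H`, where the distance of two functions is the (outer) measure
of the set on which they differ. -/
def StepSpace (H : Type u) : Type u := Set.Ico (0 : ℝ) 1 → H

namespace StepSpace

variable {H : Type u}

/-- The set on which two functions differ. -/
def diffSet (f g : StepSpace H) : Set ℝ := Subtype.val '' {r | f r ≠ g r}

theorem diffSet_subset (f g : StepSpace H) : diffSet f g ⊆ Set.Ico 0 1 := by
  rintro _ ⟨r, -, rfl⟩
  exact r.2

theorem volume_ne_top {s : Set ℝ} (hs : s ⊆ Set.Ico 0 1) : MeasureTheory.volume s ≠ ⊤ :=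
  ne_top_of_le_ne_top (by simp) (MeasureTheory.measure_mono hs)

instance : PseudoMetricSpace (StepSpace H) where
  dist f g := MeasureTheory.volume.real (diffSet f g)
  dist_self f := by simp [diffSet]
  dist_comm f g := by simp only [diffSet, ne_comm]
  dist_triangle f g h := by
    have hsub : diffSet f h ⊆ diffSet f g ∪ diffSet g h := by
      rintro _ ⟨r, hr, rfl⟩
      by_cases h' : f r = g r
      · exact Or.inr ⟨r, fun e => hr (h'.trans e), rfl⟩
      · exact Or.inl ⟨r, h', rfl⟩
    refine (MeasureTheory.measureReal_mono hsub ?_).trans (MeasureTheory.measureReal_union_le _ _)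
    exact volume_ne_top (Set.union_subset (diffSet_subset f g) (diffSet_subset g h))

theorem dist_def (f g : StepSpace H) : dist f g = MeasureTheory.volume.real (diffSet f g) := rfl

variable [Group H]

instance : MulAction H (StepSpace H) where
  smul h f := fun r => h * f r
  one_smul f := funext fun r => one_mul (f r)
  mul_smul a b f := funext fun r => mul_assoc a b (f r)

theorem smul_apply (h : H) (f : StepSpace H) (r : Set.Ico (0 : ℝ) 1) : (h • f) r = h * f r := rfl

theorem dist_smul_smul (h : H) (f g : StepSpace H) : dist (h • f) (h • g) = dist f g := by
  simp only [dist_def, diffSet, smul_apply, ne_eq, mul_right_inj]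

/-- A nontrivial left translation has no fixed values, so the two functions differ on all of `[0,
1)`. -/
theorem dist_smul_self {h : H} (hh : h ≠ 1) (f : StepSpace H) : dist (h • f) f = 1 := by
  have : diffSet (h • f) f = Set.Ico 0 1 := by
    refine Set.Subset.antisymm (diffSet_subset _ _) fun r hr => ⟨⟨r, hr⟩, ?_, rfl⟩
    change h * f _ ≠ f _
    rwa [ne_eq, mul_eq_right]
  rw [dist_def, this]
  simp

instance : ContinuousConstSMul H (StepSpace H) where
  continuous_const_smul h :=
    (Isometry.of_dist_eq fun f g => dist_smul_smul h f g).continuous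

variable (H) in
/-- The quotient of the space of step functions by the action of the group. -/
def Quot : Type u := Quotient (MulAction.orbitRel H (StepSpace H))

instance : TopologicalSpace (Quot H) :=
  inferInstanceAs (TopologicalSpace (Quotient (MulAction.orbitRel H (StepSpace H))))

/-- The projection to the quotient. -/
def proj (f : StepSpace H) : Quot H := Quotient.mk (MulAction.orbitRel H (StepSpace H)) f

/-- Nontrivial elements move every point by distance `1`, while any two points of a ball of radius
`1 / 2` are at distance less than `1`. Such a ball is therefore disjoint from its nontrivial
translates. -/
theorem isQuotientCoveringMap_proj : IsQuotientCoveringMap (proj (H := H)) H where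
  __ := (isQuotientMap_quotient_mk' :
    Topology.IsQuotientMap (Quotient.mk (MulAction.orbitRel H (StepSpace H))))
  apply_eq_iff_mem_orbit := Quotient.eq''
  disjoint f := by
    refine ⟨Metric.ball f (1 / 2), Metric.ball_mem_nhds f (by norm_num), fun h => ?_⟩
    rintro ⟨_, ⟨g, hg, rfl⟩, hg'⟩
    by_contra hh
    have h1 := dist_smul_self hh g
    have h2 := dist_triangle_right (h • g) g f
    rw [Metric.mem_ball] at hg hg'
    simp only at hg'
    linarith

end StepSpace

/-- The homomorphism on the fundamental group induced by a map to the base of a quotient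
covering, computed by lifting loops. -/
theorem exists_hom_of_covering {E Q Y : Type u} [TopologicalSpace E] [TopologicalSpace Q]
    [TopologicalSpace Y] {H : Type u} [Group H] [MulAction H E] {p : E → Q}
    (hp : IsQuotientCoveringMap p H) (g : C(Y, Q)) (y : Y) (e : E) (he : p e = g y) :
    ∃ Φ : Pi1 Y y →* H, ∀ (γ : Path y y) (Γ : C(unitInterval, E)) (h : H),
      (∀ t, p (Γ t) = g (γ t)) → Γ 0 = e → Γ 1 = h • e → Φ (Pi1.mk γ) = h := by
  -- Monodromy takes values in `Hᵐᵒᵖ`; this opposite and the one in `Pi1` cancel.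
  let Ψ := (hp.fundamentalGroupToMulOpposite (x := g y) ⟨e, he⟩).comp (FundamentalGroup.map g y)
  refine ⟨⟨⟨fun a => (Ψ a.unop).unop, by
    rw [MulOpposite.unop_one, map_one, MulOpposite.unop_one]⟩, fun a b => by
    simp only [MulOpposite.unop_mul, map_mul]⟩, fun γ Γ h hΓ h0 h1 => ?_⟩
  change (Ψ _).unop = h
  rw [← MulOpposite.op_inj, MulOpposite.op_unop]
  change hp.fundamentalGroupToMulOpposite (x := g y) ⟨e, he⟩ _ = _
  rw [hp.fundamentalGroupToMulOpposite_apply_eq_Iff, MulOpposite.unop_op, ← h1]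
  have h2 := (hp.isCoveringMap.eq_liftPath_iff' (γ := (γ.map g.continuous).toContinuousMap)
    (e := e) (γ_0 := by simp [he]) (Γ := Γ)).2 ⟨funext hΓ, h0⟩
  exact congrArg (fun c : C(unitInterval, E) => c 1) h2

/-! ### Edges of simplices -/

/-- The edge of a simplex between two of its vertices. -/
def edge (X : SSet.{u}) {n : ℕ} (σ : X _⦋n⦌) {i j : Fin (n + 1)} (h : i ≤ j) : X _⦋1⦌ :=
  X.map (SimplexCategory.mkOfLe i j h).op σ

theorem edge_map (X : SSet.{u}) {m n : ℕ} (f : ⦋m⦌ ⟶ ⦋n⦌) (σ : X _⦋n⦌) {i j : Fin (m + 1)}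
    (h : i ≤ j) : edge X (X.map f.op σ) h = edge X σ (f.toOrderHom.monotone h) := by
  unfold edge
  rw [← comp_apply, ← Functor.map_comp, ← op_comp]
  congr 4
  exact SimplexCategory.Hom.ext_one_left _ _

theorem exists_triangle (X : SSet.{u}) {n : ℕ} (σ : X _⦋n⦌) {i j k : Fin (n + 1)} (hij : i ≤ j)
    (hjk : j ≤ k) : ∃ t : X _⦋2⦌, X.δ 2 t = edge X σ hij ∧ X.δ 0 t = edge X σ hjk ∧
      X.δ 1 t = edge X σ (hij.trans hjk) := by
  refine ⟨X.map (SimplexCategory.mkOfLeComp i j k hij hjk).op σ, ?_, ?_, ?_⟩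
  all_goals
    unfold edge SimplicialObject.δ
    rw [← comp_apply, ← Functor.map_comp, ← op_comp]
    congr 4
    exact SimplexCategory.Hom.ext_one_left _ _

theorem edge_zero_one (X : SSet.{u}) (a : X _⦋1⦌) : edge X a (Fin.zero_le 1) = a := by
  unfold edge
  have h : SimplexCategory.mkOfLe (0 : Fin (1 + 1)) 1 (Fin.zero_le 1) = 𝟙 _ :=
    SimplexCategory.Hom.ext_one_left _ _
  rw [h, op_id, CategoryTheory.Functor.map_id, id_apply]

section Cocycle

variable {X : SSet.{u}} {H : Type u} [Group H] {φ : X _⦋1⦌ → H}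
  (hφ : ∀ t : X _⦋2⦌, φ (X.δ 1 t) = φ (X.δ 2 t) * φ (X.δ 0 t))

include hφ

theorem cocycle_trans {n : ℕ} (σ : X _⦋n⦌) {i j k : Fin (n + 1)} (hij : i ≤ j) (hjk : j ≤ k) :
    φ (edge X σ (hij.trans hjk)) = φ (edge X σ hij) * φ (edge X σ hjk) := by
  obtain ⟨t, h2, h0, h1⟩ := exists_triangle X σ hij hjk
  rw [← h2, ← h0, ← h1, hφ]

/-- The relation for a constant triangle makes this value idempotent in a group. -/
theorem cocycle_refl {n : ℕ} (σ : X _⦋n⦌) (i : Fin (n + 1)) : φ (edge X σ (le_refl i)) = 1 := by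
  have h := cocycle_trans hφ σ (le_refl i) (le_refl i)
  exact left_eq_mul.1 h

end Cocycle

/-- The step function attached to a point of a simplex and a function on the edges. -/
def stepOf {X : SSet.{u}} {H : Type u} (φ : X _⦋1⦌ → H) {n : ℕ} (σ : X _⦋n⦌)
    (v : stdSimplex ℝ (Fin (n + 1))) : StepSpace H :=
  fun r => φ (edge X σ (Fin.zero_le (stepFn v r)))

/-- The two functions can differ only between corresponding breakpoints, that is, between the
cumulative weights of `v` and `w`. -/
theorem dist_stepOf_le {X : SSet.{u}} {H : Type u} (φ : X _⦋1⦌ → H) {n : ℕ} (σ : X _⦋n⦌)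
    (v w : stdSimplex ℝ (Fin (n + 1))) : dist (stepOf φ σ v) (stepOf φ σ w) ≤
      ∑ j : Fin (n + 1), |(∑ i ∈ Finset.Iic j, v i) - ∑ i ∈ Finset.Iic j, w i| := by
  have hsub : StepSpace.diffSet (stepOf φ σ v) (stepOf φ σ w) ⊆ ⋃ j : Fin (n + 1),
      Set.uIcc (∑ i ∈ Finset.Iic j, v i) (∑ i ∈ Finset.Iic j, w i) := by
    rintro _ ⟨r, hr, rfl⟩
    have hne : stepFn v r ≠ stepFn w r := fun h => hr (by unfold stepOf; congr 2)
    rw [Set.mem_iUnion]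
    rcases lt_or_gt_of_ne hne with h | h
    · refine ⟨stepFn v r, Set.mem_uIcc.2 (Or.inr ⟨?_, ?_⟩)⟩
      · exact not_lt.1 fun h' => absurd ((stepFn_le_iff w r _).2 h') (not_le.2 h)
      · exact ((stepFn_le_iff v r _).1 le_rfl).le
    · refine ⟨stepFn w r, Set.mem_uIcc.2 (Or.inl ⟨?_, ?_⟩)⟩
      · exact not_lt.1 fun h' => absurd ((stepFn_le_iff v r _).2 h') (not_le.2 h)
      · exact ((stepFn_le_iff w r _).1 le_rfl).le
  have hfin : ∀ j : Fin (n + 1), MeasureTheory.volume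
      (Set.uIcc (∑ i ∈ Finset.Iic j, v i) (∑ i ∈ Finset.Iic j, w i)) ≠ ⊤ := fun j =>
    isCompact_uIcc.measure_ne_top
  rw [StepSpace.dist_def]
  refine (MeasureTheory.measureReal_mono hsub ?_).trans ?_
  · exact ne_top_of_le_ne_top (ENNReal.sum_ne_top.2 fun j _ => hfin j)
      (MeasureTheory.measure_iUnion_fintype_le _ _)
  · refine (MeasureTheory.measureReal_iUnion_fintype_le _).trans
      (Finset.sum_le_sum fun j _ => ?_)
    rw [MeasureTheory.measureReal_def, Real.volume_interval, ENNReal.toReal_ofReal (abs_nonneg _),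
      abs_sub_comm]

theorem continuous_stepOf {X : SSet.{u}} {H : Type u} (φ : X _⦋1⦌ → H) {n : ℕ} (σ : X _⦋n⦌) :
    Continuous (stepOf φ σ) := by
  rw [continuous_iff_continuousAt]
  intro v
  rw [ContinuousAt, tendsto_iff_dist_tendsto_zero]
  refine squeeze_zero (fun _ => dist_nonneg) (fun w => dist_stepOf_le φ σ w v) ?_
  have hc : Continuous fun w : stdSimplex ℝ (Fin (n + 1)) => ∑ j : Fin (n + 1),
      |(∑ i ∈ Finset.Iic j, w i) - ∑ i ∈ Finset.Iic j, v i| := by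
    have : ∀ i, Continuous fun w : stdSimplex ℝ (Fin (n + 1)) => w i := fun i =>
      (continuous_apply i).comp continuous_subtype_val
    fun_prop
  have := hc.tendsto v
  simpa using this

/-- A function on the edges of `X` satisfying the cocycle condition on triangles extends to a
homomorphism on the fundamental group. -/
theorem exists_hom_of_cocycle (X : SSet.{u}) (x : X _⦋0⦌) (hx : ∀ y : X _⦋0⦌, y = x)
    {H : Type u} [Group H] (φ : X _⦋1⦌ → H)
    (hφ : ∀ t : X _⦋2⦌, φ (X.δ 1 t) = φ (X.δ 2 t) * φ (X.δ 0 t)) :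
    ∃ Φ : Pi1 |X| (vertexPoint X x) →* H, ∀ a : X _⦋1⦌, Φ (edgeClass X x hx a) = φ a := by
  obtain ⟨g, hg⟩ := exists_desc X (T := StepSpace.Quot H)
    (fun n σ => ⟨fun v => StepSpace.proj (stepOf φ σ v),
      StepSpace.isQuotientCoveringMap_proj.continuous.comp (continuous_stepOf φ σ)⟩)
    (fun m n f σ v => by
      refine StepSpace.isQuotientCoveringMap_proj.apply_eq_iff_mem_orbit.2
        -- Applying `f` changes the initial vertex from which edges are measured. By the cocycle
        -- condition this is a left translation by a constant, invisible in the quotient.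
        ⟨(φ (edge X σ (Fin.zero_le (f.toOrderHom 0))))⁻¹, funext fun r => ?_⟩
      change _ * φ _ = φ _
      rw [inv_mul_eq_iff_eq_mul, edge_map, ← cocycle_trans hφ]
      congr 2
      exact stepFn_map f.toOrderHom v r)
  have hone : stepOf φ x default = (fun _ => 1 : StepSpace H) := by
    funext r
    have h : stepFn (default : stdSimplex ℝ (Fin (0 + 1))) r = 0 := Fin.fin_one_eq_zero _
    unfold stepOf
    simp only [h]
    exact cocycle_refl hφ x 0
  obtain ⟨Φ, hΦ⟩ := exists_hom_of_covering StepSpace.isQuotientCoveringMap_proj g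
    (vertexPoint X x) (fun _ => 1 : StepSpace H) (by
      rw [vertexPoint, hg, ← hone]
      rfl)
  -- The loop of `a` lifts to the step functions equal to `1` on `[0, 1 - t)` and to `φ a` on `[1 -
  -- t, 1)`, which run from the constant `1` to the constant `φ a`.
  refine ⟨Φ, fun a => hΦ _
    ⟨fun t => stepOf φ a (stdSimplexHomeomorphUnitInterval.symm t),
      (continuous_stepOf φ a).comp stdSimplexHomeomorphUnitInterval.symm.continuous⟩ _
    (fun t => (hg 1 a _).symm) ?_ ?_⟩
  · funext r
    have h : stepFn (stdSimplexHomeomorphUnitInterval.symm 0) r = 0 := by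
      rw [← Fin.le_zero_iff, stepFn_le_iff]
      have : Finset.Iic (0 : Fin (1 + 1)) = {0} := by decide
      rw [this, Finset.sum_singleton]
      exact r.2.2.trans_eq (sub_zero (1 : ℝ)).symm
    change φ (edge X a _) = 1
    simp only [h]
    exact cocycle_refl hφ a 0
  · funext r
    have h : stepFn (stdSimplexHomeomorphUnitInterval.symm 1) r = 1 := by
      by_contra hne
      have hlt : stepFn (stdSimplexHomeomorphUnitInterval.symm 1) r ≤ (0 : Fin (1 + 1)) := by
        generalize stepFn (stdSimplexHomeomorphUnitInterval.symm 1) r = j at hne ⊢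
        fin_cases j
        · exact le_rfl
        · exact absurd rfl hne
      rw [stepFn_le_iff] at hlt
      have : Finset.Iic (0 : Fin (1 + 1)) = {0} := by decide
      rw [this, Finset.sum_singleton] at hlt
      exact absurd (hlt.trans_eq (sub_self (1 : ℝ))) (not_lt.2 r.2.1)
    change φ (edge X a _) = φ a * 1
    simp only [h]
    rw [mul_one, edge_zero_one]

/-! ### Pushing a collar of the boundary of a simplex into the boundary -/

/-- The smallest barycentric coordinate. -/
def minCoord {n : ℕ} (v : stdSimplex ℝ (Fin (n + 1))) : ℝ :=
  Finset.univ.inf' Finset.univ_nonempty fun i => v i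

theorem minCoord_le {n : ℕ} (v : stdSimplex ℝ (Fin (n + 1))) (i : Fin (n + 1)) :
    minCoord v ≤ v i := Finset.inf'_le _ (Finset.mem_univ i)

theorem exists_minCoord_eq {n : ℕ} (v : stdSimplex ℝ (Fin (n + 1))) :
    ∃ i, v i = minCoord v := by
  obtain ⟨i, -, hi⟩ := Finset.exists_mem_eq_inf' (Finset.univ_nonempty (α := Fin (n + 1)))
    fun i => v i
  exact ⟨i, hi.symm⟩

theorem minCoord_nonneg {n : ℕ} (v : stdSimplex ℝ (Fin (n + 1))) : 0 ≤ minCoord v := by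
  obtain ⟨i, hi⟩ := exists_minCoord_eq v
  exact hi ▸ v.2.1 i

theorem continuous_coord {n : ℕ} (i : Fin (n + 1)) :
    Continuous fun v : stdSimplex ℝ (Fin (n + 1)) => v i :=
  (continuous_apply i).comp continuous_subtype_val

theorem continuous_minCoord {n : ℕ} :
    Continuous (minCoord : stdSimplex ℝ (Fin (n + 1)) → ℝ) :=
  Continuous.finset_inf'_apply _ fun i _ => continuous_coord i

/-- The width of the collar. -/
def collar (n : ℕ) : ℝ := 1 / (2 * (n + 1))

theorem collar_pos (n : ℕ) : 0 < collar n := by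
  unfold collar
  positivity

/-- The amount subtracted from each coordinate at time `s`. -/
def pushDepth {n : ℕ} (s : unitInterval) (v : stdSimplex ℝ (Fin (n + 1))) : ℝ :=
  s * min (minCoord v) (collar n)

theorem pushDepth_le {n : ℕ} (s : unitInterval) (v : stdSimplex ℝ (Fin (n + 1)))
    (i : Fin (n + 1)) : pushDepth s v ≤ v i := by
  have h0 : 0 ≤ min (minCoord v) (collar n) := le_min (minCoord_nonneg v) (collar_pos n).le
  calc pushDepth s v ≤ min (minCoord v) (collar n) := mul_le_of_le_one_left h0 s.2.2
    _ ≤ minCoord v := min_le_left _ _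
    _ ≤ v i := minCoord_le v i

theorem pushDepth_denom_pos {n : ℕ} (s : unitInterval) (v : stdSimplex ℝ (Fin (n + 1))) :
    0 < 1 - (n + 1) * pushDepth s v := by
  have h0 : 0 ≤ min (minCoord v) (collar n) := le_min (minCoord_nonneg v) (collar_pos n).le
  have h1 : pushDepth s v ≤ collar n :=
    (mul_le_of_le_one_left h0 s.2.2).trans (min_le_right _ _)
  have hn : (0 : ℝ) < n + 1 := by positivity
  -- The collar is half of `1 / (n + 1)`, the largest possible `minCoord`, so the denominator stays
  -- at least `1 / 2` even at the barycentre.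
  have h2 : (n + 1) * collar n = 1 / 2 := by
    unfold collar
    field_simp
  have h3 : (n + 1) * pushDepth s v ≤ (n + 1) * collar n := mul_le_mul_of_nonneg_left h1 hn.le
  linarith

/-- The deformation of the simplex which subtracts a multiple of the smallest coordinate, at most
the width of the collar, from all coordinates and rescales. -/
def push {n : ℕ} (s : unitInterval) (v : stdSimplex ℝ (Fin (n + 1))) :
    stdSimplex ℝ (Fin (n + 1)) :=
  ⟨fun i => (v i - pushDepth s v) / (1 - (n + 1) * pushDepth s v),
    fun i => div_nonneg (sub_nonneg.2 (pushDepth_le s v i)) (pushDepth_denom_pos s v).le, by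
      rw [← Finset.sum_div, Finset.sum_sub_distrib, stdSimplex.sum_eq_one]
      rw [Finset.sum_const, Finset.card_univ, Fintype.card_fin, nsmul_eq_mul]
      push_cast
      exact div_self (pushDepth_denom_pos s v).ne'⟩

theorem push_apply {n : ℕ} (s : unitInterval) (v : stdSimplex ℝ (Fin (n + 1)))
    (i : Fin (n + 1)) :
    push s v i = (v i - pushDepth s v) / (1 - (n + 1) * pushDepth s v) := rfl

theorem continuous_push {n : ℕ} :
    Continuous fun p : unitInterval × stdSimplex ℝ (Fin (n + 1)) => push p.1 p.2 := by
  have hd : Continuous fun p : unitInterval × stdSimplex ℝ (Fin (n + 1)) =>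
      pushDepth p.1 p.2 := by
    unfold pushDepth
    have := (continuous_minCoord (n := n))
    fun_prop
  refine Continuous.subtype_mk (continuous_pi fun i => Continuous.div ?_ ?_ ?_) _
  · exact ((continuous_coord i).comp continuous_snd).sub hd
  · fun_prop
  · exact fun p => (pushDepth_denom_pos p.1 p.2).ne'

theorem push_eq_self {n : ℕ} {s : unitInterval} {v : stdSimplex ℝ (Fin (n + 1))}
    (h : pushDepth s v = 0) : push s v = v := by
  refine stdSimplex.ext (funext fun i => ?_)
  rw [push_apply, h]
  simp

theorem push_zero {n : ℕ} (v : stdSimplex ℝ (Fin (n + 1))) : push 0 v = v :=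
  push_eq_self (by simp [pushDepth])

theorem push_of_coord_eq_zero {n : ℕ} (s : unitInterval) {v : stdSimplex ℝ (Fin (n + 1))}
    {i : Fin (n + 1)} (hi : v i = 0) : push s v = v := by
  refine push_eq_self ?_
  have h : minCoord v = 0 := le_antisymm (hi ▸ minCoord_le v i) (minCoord_nonneg v)
  rw [pushDepth, h, min_eq_left (collar_pos n).le, mul_zero]

theorem exists_push_one_eq_zero {n : ℕ} {v : stdSimplex ℝ (Fin (n + 1))}
    (h : minCoord v ≤ collar n) : ∃ i, push 1 v i = 0 := by
  obtain ⟨i, hi⟩ := exists_minCoord_eq v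
  refine ⟨i, ?_⟩
  rw [push_apply, pushDepth, min_eq_left h, hi]
  simp

/-- The track of a point under the deformation `push`. -/
def pushTrack {n : ℕ} (v : stdSimplex ℝ (Fin (n + 1))) :
    C(unitInterval, stdSimplex ℝ (Fin (n + 1))) :=
  ⟨fun s => push s v, continuous_push.comp (by fun_prop : Continuous fun s => (s, v))⟩

theorem continuous_pushTrack {n : ℕ} :
    Continuous (pushTrack : stdSimplex ℝ (Fin (n + 1)) → _) :=
  ContinuousMap.continuous_of_continuous_uncurry _ <|
    continuous_push.comp (continuous_snd.prodMk continuous_fst)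

/-! ### The induced deformation of the skeleton -/

open Classical in
/-- The track of a point of `|X|` under the deformation `push` of the nondegenerate `n`-simplices;
it is constant outside of their interiors. -/
def cellPush (X : SSet.{u}) (n : ℕ) (y : |X|) : C(unitInterval, |X|) :=
  if h : ∃ p : X _⦋n⦌ × stdSimplex ℝ (Fin (n + 1)), p.1 ∈ X.nonDegenerate n ∧ (∀ i, 0 < p.2 i) ∧
      simplexMap X p.1 p.2 = y
  then (simplexMap X h.choose.1).comp (pushTrack h.choose.2)
  else ContinuousMap.const _ y

theorem cellPush_of_mem_skel (X : SSet.{u}) {n : ℕ} {y : |X|} (hy : y ∈ skel X n) :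
    cellPush X n y = ContinuousMap.const _ y := by
  refine dif_neg ?_
  rintro ⟨p, hp, hpos, rfl⟩
  exact interior_notMem_skel X hp hpos hy

/-- In the interior, uniqueness of normal forms identifies the chosen representative. On the
boundary `push` is stationary, which agrees with the constant track. -/
theorem cellPush_simplexMap (X : SSet.{u}) {n : ℕ} {σ : X _⦋n⦌} (hσ : σ ∈ X.nonDegenerate n)
    (v : stdSimplex ℝ (Fin (n + 1))) :
    cellPush X n (simplexMap X σ v) = (simplexMap X σ).comp (pushTrack v) := by
  by_cases hv : ∀ i, 0 < v i
  · have h : ∃ p : X _⦋n⦌ × stdSimplex ℝ (Fin (n + 1)), p.1 ∈ X.nonDegenerate n ∧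
        (∀ i, 0 < p.2 i) ∧ simplexMap X p.1 p.2 = simplexMap X σ v := ⟨(σ, v), hσ, hv, rfl⟩
    rw [cellPush, dif_pos h]
    obtain ⟨h1, h2, h3⟩ := h.choose_spec
    have e := normalForm_unique X h1 hσ h2 hv h3
    simp only [Sigma.mk.injEq, true_and, heq_eq_eq, Prod.mk.injEq] at e
    rw [e.1, e.2]
  · push Not at hv
    obtain ⟨i, hi⟩ := hv
    have hi0 : v i = 0 := le_antisymm hi (v.2.1 i)
    rw [cellPush_of_mem_skel X (mem_skel_of_coord_eq_zero X σ hi0)]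
    ext s
    exact congrArg (simplexMap X σ) (push_of_coord_eq_zero s hi0).symm

theorem mem_skel_succ_cases (X : SSet.{u}) {n : ℕ} {y : |X|} (hy : y ∈ skel X (n + 1)) :
    y ∈ skel X n ∨ ∃ (σ : X _⦋n⦌) (_ : σ ∈ X.nonDegenerate n)
      (v : stdSimplex ℝ (Fin (n + 1))) (_ : ∀ i, 0 < v i), simplexMap X σ v = y := by
  obtain ⟨m, hm, σ, hσ, v, hv, rfl⟩ := exists_normalForm_of_mem_skel X _ hy
  by_cases h : m < n
  · exact Or.inl (simplexMap_mem_skel X h σ v)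
  · obtain rfl : m = n := by omega
    exact Or.inr ⟨σ, hσ, v, hv, rfl⟩

/-- Since the deformation is written as a map into the path space, continuity can be tested on one
nondegenerate simplex at a time, without discussing the topology of a product of `|X|` with the
interval. -/
theorem continuousOn_cellPush (X : SSet.{u}) (n : ℕ) :
    ContinuousOn (cellPush X n) (skel X (n + 1)) := by
  rw [continuousOn_iff_isClosed]
  intro t ht
  refine ⟨cellPush X n ⁻¹' t ∩ skel X (n + 1), ?_, by rw [Set.inter_assoc, Set.inter_self]⟩
  refine isClosed_of_subset_skel X Set.inter_subset_right fun m hm σ hσ => ?_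
  have h : simplexMap X σ ⁻¹' (cellPush X n ⁻¹' t ∩ skel X (n + 1)) =
      (fun v => cellPush X n (simplexMap X σ v)) ⁻¹' t := by
    ext v
    exact ⟨fun hv => hv.1, fun hv => ⟨hv, simplexMap_mem_skel X hm σ v⟩⟩
  rw [h]
  refine ht.preimage ?_
  rcases Nat.lt_or_ge m n with hmn | hmn
  · have : (fun v => cellPush X n (simplexMap X σ v)) =
        fun v => ContinuousMap.const _ (simplexMap X σ v) :=
      funext fun v => cellPush_of_mem_skel X (simplexMap_mem_skel X hmn σ v)
    rw [this]
    exact ContinuousMap.continuous_const'.comp (simplexMap X σ).continuous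
  · obtain rfl : m = n := by omega
    have : (fun v => cellPush X m (simplexMap X σ v)) =
        fun v => (simplexMap X σ).comp (pushTrack v) := funext fun v => cellPush_simplexMap X hσ v
    rw [this]
    exact (ContinuousMap.continuous_postcomp _).comp continuous_pushTrack

theorem cellPush_zero (X : SSet.{u}) (n : ℕ) {y : |X|} (hy : y ∈ skel X (n + 1)) :
    cellPush X n y 0 = y := by
  obtain h | ⟨σ, hσ, v, hv, rfl⟩ := mem_skel_succ_cases X hy
  · rw [cellPush_of_mem_skel X h]
    rfl
  · rw [cellPush_simplexMap X hσ]
    exact congrArg (simplexMap X σ) (push_zero v)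

/-- Tracks stay inside one simplex, so the tracks of the endpoints of a path are covered by the
simplex case of `path_induction`. -/
theorem exists_cellPush_eq (X : SSet.{u}) (n : ℕ) {y : |X|} (hy : y ∈ skel X (n + 1)) :
    ∃ (m : ℕ) (σ : X _⦋m⦌) (c : C(unitInterval, stdSimplex ℝ (Fin (m + 1)))),
      cellPush X n y = (simplexMap X σ).comp c := by
  obtain h | ⟨σ, hσ, v, hv, rfl⟩ := mem_skel_succ_cases X hy
  · obtain ⟨m, hm, σ, v, rfl⟩ := h
    exact ⟨m, σ, ContinuousMap.const _ v, cellPush_of_mem_skel X (simplexMap_mem_skel X hm σ v)⟩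
  · exact ⟨n, σ, pushTrack v, cellPush_simplexMap X hσ v⟩

/-- The part of the `n`-skeleton at depth at least the collar width. -/
def core (X : SSet.{u}) (n : ℕ) : Set |X| :=
  {y | ∃ (σ : X _⦋n⦌) (_ : σ ∈ X.nonDegenerate n) (v : stdSimplex ℝ (Fin (n + 1))),
    collar n ≤ minCoord v ∧ simplexMap X σ v = y}

theorem isClosed_core (X : SSet.{u}) (n : ℕ) : IsClosed (core X n) := by
  have hpos : ∀ {v : stdSimplex ℝ (Fin (n + 1))}, collar n ≤ minCoord v → ∀ i, 0 < v i :=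
    fun h i => (collar_pos n).trans_le (h.trans (minCoord_le _ i))
  refine isClosed_of_nonDegenerate X fun m σ hσ => ?_
  by_cases hm : m = n
  · subst hm
    refine ⟨{v | collar m ≤ minCoord v}, isClosed_le continuous_const continuous_minCoord,
      fun v hv => ⟨σ, hσ, v, hv, rfl⟩, ?_⟩
    rintro v hv ⟨τ, hτ, w, hw, e⟩
    have e := normalForm_unique X hτ hσ (hpos hw) hv e
    simp only [Sigma.mk.injEq, true_and, heq_eq_eq, Prod.mk.injEq] at e
    rw [← e.2]
    exact hw
  · refine ⟨∅, isClosed_empty, Set.empty_subset _, ?_⟩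
    rintro v hv ⟨τ, hτ, w, hw, e⟩
    exact absurd (congrArg Sigma.fst (normalForm_unique X hσ hτ hv (hpos hw) e.symm)) hm

/-- Outside the core the smallest coordinate is at most the collar width, and at time `1` it is
subtracted completely. -/
theorem cellPush_one_mem_skel (X : SSet.{u}) {n : ℕ} {y : |X|} (hy : y ∈ skel X (n + 1))
    (hc : y ∉ core X n) : cellPush X n y 1 ∈ skel X n := by
  obtain h | ⟨σ, hσ, v, hv, rfl⟩ := mem_skel_succ_cases X hy
  · rw [cellPush_of_mem_skel X h]
    exact h
  · rw [cellPush_simplexMap X hσ]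
    have hmin : minCoord v ≤ collar n := by
      by_contra hlt
      exact hc ⟨σ, hσ, v, (not_le.1 hlt).le, rfl⟩
    obtain ⟨i, hi⟩ := exists_push_one_eq_zero hmin
    exact mem_skel_of_coord_eq_zero X σ hi

theorem core_disjoint_skel (X : SSet.{u}) {n : ℕ} {y : |X|} (hc : y ∈ core X n) :
    y ∉ skel X n := by
  obtain ⟨σ, hσ, v, hv, rfl⟩ := hc
  exact interior_notMem_skel X hσ fun i => (collar_pos n).trans_le (hv.trans (minCoord_le v i))

/-- Unions of closed subsets of the nondegenerate `n`-simplices with the lower skeleton. -/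
def cells (X : SSet.{u}) (n : ℕ) (W : X _⦋n⦌ → Set (stdSimplex ℝ (Fin (n + 1)))) : Set |X| :=
  {y | y ∈ skel X n ∨ ∃ (σ : X _⦋n⦌) (_ : σ ∈ X.nonDegenerate n), ∃ v ∈ W σ, simplexMap X σ v = y}

theorem simplexMap_mem_cells_iff (X : SSet.{u}) {n : ℕ}
    (W : X _⦋n⦌ → Set (stdSimplex ℝ (Fin (n + 1)))) {σ : X _⦋n⦌} (hσ : σ ∈ X.nonDegenerate n)
    {v : stdSimplex ℝ (Fin (n + 1))} (hv : ∀ i, 0 < v i) :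
    simplexMap X σ v ∈ cells X n W ↔ v ∈ W σ := by
  constructor
  · rintro (h | ⟨τ, hτ, w, hw, e⟩)
    · exact absurd h (interior_notMem_skel X hσ hv)
    · by_cases hpos : ∀ i, 0 < w i
      · have e := normalForm_unique X hτ hσ hpos hv e
        simp only [Sigma.mk.injEq, true_and, heq_eq_eq, Prod.mk.injEq] at e
        rw [← e.1, ← e.2]
        exact hw
      · push Not at hpos
        obtain ⟨i, hi⟩ := hpos
        have := mem_skel_of_coord_eq_zero X τ (le_antisymm hi (w.2.1 i))
        rw [e] at this
        exact absurd this (interior_notMem_skel X hσ hv)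
  · exact fun h => Or.inr ⟨σ, hσ, v, h, rfl⟩

theorem isClosed_cells (X : SSet.{u}) {n : ℕ}
    (W : X _⦋n⦌ → Set (stdSimplex ℝ (Fin (n + 1)))) (hW : ∀ σ, IsClosed (W σ)) :
    IsClosed (cells X n W) := by
  refine isClosed_of_nonDegenerate X fun m σ hσ => ?_
  rcases lt_trichotomy m n with h | rfl | h
  · exact ⟨Set.univ, isClosed_univ, fun v _ => Or.inl (simplexMap_mem_skel X h σ v),
      fun _ _ _ => trivial⟩
  · exact ⟨W σ, hW σ, fun v hv => Or.inr ⟨σ, hσ, v, hv, rfl⟩,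
      fun v hv hv' => (simplexMap_mem_cells_iff X W hσ hv).1 hv'⟩
  · refine ⟨∅, isClosed_empty, Set.empty_subset _, fun v hv hv' => ?_⟩
    refine absurd ?_ (interior_notMem_skel X hσ hv)
    rcases hv' with hv' | ⟨τ, -, w, -, e⟩
    · exact skel_mono X h.le hv'
    · exact ⟨n, h, τ, w, e⟩

theorem isClosed_skel (X : SSet.{u}) (n : ℕ) : IsClosed (skel X n) :=
  isClosed_of_subset_skel X subset_rfl fun m hm σ _ => by
    have : simplexMap X σ ⁻¹' skel X n = Set.univ :=
      Set.eq_univ_of_forall fun v => simplexMap_mem_skel X hm σ v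
    rw [this]
    exact isClosed_univ

/-- A connected family of points in the open `n`-cells lies in a single cell, and its coordinates
depend continuously on the parameter. -/
theorem exists_lift_of_isPreconnected (X : SSet.{u}) {n : ℕ} {T : Type*} [TopologicalSpace T]
    [PreconnectedSpace T] [Nonempty T] (γ : C(T, |X|)) (h1 : ∀ t, γ t ∈ skel X (n + 1))
    (h2 : ∀ t, γ t ∉ skel X n) :
    ∃ (σ : X _⦋n⦌) (_ : σ ∈ X.nonDegenerate n) (c : C(T, stdSimplex ℝ (Fin (n + 1)))),
      ∀ t, γ t = simplexMap X σ (c t) := by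
  have hex : ∀ t, ∃ (σ : X _⦋n⦌) (_ : σ ∈ X.nonDegenerate n)
      (v : stdSimplex ℝ (Fin (n + 1))) (_ : ∀ i, 0 < v i), simplexMap X σ v = γ t := fun t =>
    (mem_skel_succ_cases X (h1 t)).resolve_left (h2 t)
  choose σ hσ c hc e using hex
  -- Closed subsets may be prescribed independently in each cell. Equal choices give continuity of
  -- the coordinates; choices of everything or nothing show that the cell containing `γ t` is
  -- locally constant.
  have hpre : ∀ W : X _⦋n⦌ → Set (stdSimplex ℝ (Fin (n + 1))), (∀ τ, IsClosed (W τ)) →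
      IsClosed {t | c t ∈ W (σ t)} := fun W hW => by
    have h : {t | c t ∈ W (σ t)} = γ ⁻¹' cells X n W := by
      ext t
      rw [Set.mem_preimage, ← e t]
      exact (simplexMap_mem_cells_iff X W (hσ t) (hc t)).symm
    rw [h]
    exact (isClosed_cells X W hW).preimage γ.continuous
  have hcont : Continuous c := continuous_iff_isClosed.2 fun F hF => hpre (fun _ => F) fun _ => hF
  let t₀ : T := Classical.arbitrary T
  have hconst : ∀ t, σ t = σ t₀ := by
    have hclopen : IsClopen {t | σ t = σ t₀} := by
      have hcl : ∀ Λ : Set (X _⦋n⦌), IsClosed {t | σ t ∈ Λ} := fun Λ => by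
        classical
        have := hpre (fun τ => {_v | τ ∈ Λ}) fun τ => isClosed_const
        exact this
      refine ⟨hcl {σ t₀}, ?_⟩
      convert (hcl {σ t₀}ᶜ).isOpen_compl using 1
      ext t
      simp
    have := hclopen.eq_univ ⟨t₀, rfl⟩
    exact fun t => this.ge (Set.mem_univ t)
  exact ⟨σ t₀, hσ t₀, ⟨c, hcont⟩, fun t => by rw [← e t, hconst t]; rfl⟩

/-! ### Paths in the geometric realization -/

instance instSimplyConnectedSquare : SimplyConnectedSpace (unitInterval × unitInterval) := by
  have h : ContractibleSpace ↥(unitInterval ×ˢ unitInterval) :=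
    ((convex_Icc (0 : ℝ) 1).prod (convex_Icc (0 : ℝ) 1)).contractibleSpace
      ⟨(0, 0), by simp⟩
  have : ContractibleSpace (unitInterval × unitInterval) :=
    (Homeomorph.Set.prod unitInterval unitInterval).symm.contractibleSpace
  infer_instance

instance instSimplyConnectedStdSimplex (n : ℕ) :
    SimplyConnectedSpace (stdSimplex ℝ (Fin (n + 1))) := by
  have : ContractibleSpace (stdSimplex ℝ (Fin (n + 1))) :=
    (convex_stdSimplex ℝ (Fin (n + 1))).contractibleSpace
      ⟨_, (stdSimplex.vertex (S := ℝ) (0 : Fin (n + 1))).2⟩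
  infer_instance

/-- A homotopy-invariant property of paths in `|X|` which is closed under composition and holds for
paths inside of simplices holds for all paths. -/
theorem path_induction (X : SSet.{u}) (P : ∀ ⦃y z : |X|⦄, Path y z → Prop)
    (hhom : ∀ (y z : |X|) (p q : Path y z), p.Homotopic q → P p → P q)
    (htrans : ∀ (y z w : |X|) (p : Path y z) (q : Path z w), P p → P q → P (p.trans q))
    (hsimp : ∀ (n : ℕ) (σ : X _⦋n⦌) (v w : stdSimplex ℝ (Fin (n + 1))) (c : Path v w),
      P (c.map (simplexMap X σ).continuous)) {y z : |X|} (p : Path y z) : P p := by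
  have hcongr : ∀ {y z y' z' : |X|} (p : Path y z) (q : Path y' z'), (∀ t, p t = q t) →
      P p → P q := by
    intro y z y' z' p q h hp
    obtain rfl : y = y' := by rw [← p.source, ← q.source, h]
    obtain rfl : z = z' := by rw [← p.target, ← q.target, h]
    obtain rfl : p = q := Path.ext (funext h)
    exact hp
  have hsimp' : ∀ {y z : |X|} (p : Path y z) (n : ℕ) (σ : X _⦋n⦌)
      (c : C(unitInterval, stdSimplex ℝ (Fin (n + 1)))), (∀ t, p t = simplexMap X σ (c t)) →
      P p := fun p n σ c h =>
    hcongr _ p (fun t => (h t).symm) (hsimp n σ _ _ ⟨c, rfl, rfl⟩)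
  -- By compactness the path lies in some skeleton, which allows induction on the skeleton.
  suffices h : ∀ (n : ℕ) {y z : |X|} (p : Path y z), (∀ t, p t ∈ skel X n) → P p by
    obtain ⟨n, hn⟩ := exists_subset_skel_of_isCompact X (isCompact_range p.continuous)
    exact h n p fun t => hn ⟨t, rfl⟩
  intro n
  induction n with
  | zero =>
    intro y z p hp
    obtain ⟨m, hm, -⟩ := hp 0
    omega
  | succ n ih =>
  intro y z p hp
  have hcont : Continuous fun t => cellPush X n (p t) :=
    (continuousOn_cellPush X n).comp_continuous p.continuous hp
  -- One side of this square is `p`, the opposite side is the pushed path, and the remaining two are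
  -- tracks of endpoints. Since the square is simply connected, `p` is homotopic to the path along
  -- the other three sides.
  let K : C(unitInterval × unitInterval, |X|) := ⟨fun q => cellPush X n (p q.2) q.1,
    (hcont.comp continuous_snd).eval continuous_fst⟩
  have hK0 : ∀ t, K (0, t) = p t := fun t => cellPush_zero X n (hp t)
  let left : Path ((0 : unitInterval), (0 : unitInterval)) (0, 1) :=
    ⟨⟨fun t => (0, t), by fun_prop⟩, rfl, rfl⟩
  let right : Path ((1 : unitInterval), (0 : unitInterval)) (1, 1) :=
    ⟨⟨fun t => (1, t), by fun_prop⟩, rfl, rfl⟩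
  let bottom : Path ((0 : unitInterval), (0 : unitInterval)) (1, 0) :=
    ⟨⟨fun t => (t, 0), by fun_prop⟩, rfl, rfl⟩
  let top : Path ((0 : unitInterval), (1 : unitInterval)) (1, 1) :=
    ⟨⟨fun t => (t, 1), by fun_prop⟩, rfl, rfl⟩
  have hhomotopic : Path.Homotopic (bottom.trans (right.trans top.symm)) left :=
    SimplyConnectedSpace.paths_homotopic _ _
  refine hcongr (left.map K.continuous) p hK0 (hhom _ _ _ _ (hhomotopic.map K) ?_)
  rw [Path.map_trans, Path.map_trans]
  have hbottom : P (bottom.map K.continuous) := by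
    obtain ⟨m, σ, c, hc⟩ := exists_cellPush_eq X n (hp 0)
    exact hsimp' _ m σ c fun t => DFunLike.congr_fun hc t
  have htop : P (top.symm.map K.continuous) := by
    obtain ⟨m, σ, c, hc⟩ := exists_cellPush_eq X n (hp 1)
    exact hsimp' _ m σ (c.comp ⟨unitInterval.symm, unitInterval.continuous_symm⟩)
      fun t => DFunLike.congr_fun hc (unitInterval.symm t)
  refine htrans _ _ _ _ _ hbottom (htrans _ _ _ _ _ ?_ htop)
  -- The pushed path is cut into pieces in the lower skeleton and pieces in a single simplex.
  let q := right.map K.continuous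
  let U : Bool → Set unitInterval := fun b =>
    bif b then p ⁻¹' (core X n)ᶜ else p ⁻¹' (skel X n)ᶜ
  obtain ⟨t, ht0, htmono, ⟨N, hN⟩, htU⟩ :=
    exists_monotone_Icc_subset_open_cover_unitInterval (c := U)
      (by
        rintro (_ | _)
        · exact (isClosed_skel X n).isOpen_compl.preimage p.continuous
        · exact (isClosed_core X n).isOpen_compl.preimage p.continuous)
      (fun s _ => by
        by_cases hs : p s ∈ core X n
        · exact Set.mem_iUnion.2 ⟨false, core_disjoint_skel X hs⟩
        · exact Set.mem_iUnion.2 ⟨true, hs⟩)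
  have hmem : ∀ {a b : unitInterval} (_ : a ≤ b) (s : unitInterval),
      Set.Icc.convexComb a b s ∈ Set.Icc a b := fun {a b} hab s => by
    have := Path.range_subpathAux a b
    rw [Set.uIcc_of_le hab] at this
    exact this ▸ Set.mem_range_self s
  have hpiece : ∀ k, P (q.subpath (t k) (t (k + 1))) := fun k => by
    have hle := htmono (Nat.le_succ k)
    -- A piece avoiding the core is pushed into the lower skeleton, where induction applies. A piece
    -- avoiding the lower skeleton stays in one open cell and is pushed within that simplex.
    obtain ⟨b, hb⟩ := htU k
    cases b with
    | true =>
      exact ih _ fun s => cellPush_one_mem_skel X (hp _) (hb (hmem hle s))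
    | false =>
      obtain ⟨σ, hσ, c, hc⟩ := exists_lift_of_isPreconnected X (n := n)
        (p.subpath (t k) (t (k + 1))).toContinuousMap (fun s => hp _)
        (fun s => hb (hmem hle s))
      refine hsimp' _ n σ ⟨fun s => push 1 (c s),
        continuous_push.comp (by fun_prop : Continuous fun s => ((1 : unitInterval), c s))⟩
        fun s => ?_
      change cellPush X n (p.subpath (t k) (t (k + 1)) s) 1 = _
      have : p.subpath (t k) (t (k + 1)) s = simplexMap X σ (c s) := hc s
      rw [this, cellPush_simplexMap X hσ]
      rfl
  have hinit : ∀ k, P (q.subpath (t 0) (t k)) := fun k => by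
    induction k with
    | zero =>
      obtain ⟨m, σ, c, hc⟩ := exists_cellPush_eq X n (hp (t 0))
      refine hsimp' _ m σ (ContinuousMap.const _ (c 1)) fun s => ?_
      rw [Path.subpath_self]
      exact DFunLike.congr_fun hc 1
    | succ k ihk =>
      exact hhom _ _ _ _ ⟨Path.Homotopy.subpathTransSubpath q (t 0) (t k) (t (k + 1))⟩
        (htrans _ _ _ _ _ ihk (hpiece k))
  refine hcongr _ q (fun s => ?_) (hinit N)
  have h1 := hN N le_rfl
  rw [ht0, h1, Path.subpath_zero_one]
  rfl

/-! ### Generation of the fundamental group by edges -/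

/-- Homotopy classes of paths with a fixed starting point. -/
def PathsFrom (Y : Type u) [TopologicalSpace Y] (b : Y) : Type u :=
  Σ y : Y, Path.Homotopic.Quotient b y

namespace PathsFrom

variable {Y : Type u} [TopologicalSpace Y] {b : Y}

/-- The class of a path. -/
def mk {y : Y} (p : Path b y) : PathsFrom Y b := ⟨y, Path.Homotopic.Quotient.mk p⟩

theorem mk_congr {y z : Y} {p : Path b y} {q : Path b z} (h : ∀ t, p t = q t) : mk p = mk q := by
  obtain rfl : y = z := by rw [← p.target, ← q.target, h]
  obtain rfl : p = q := Path.ext (funext h)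
  rfl

theorem mk_eq_iff {y : Y} {p q : Path b y} : mk p = mk q ↔ p.Homotopic q := by
  rw [← Path.Homotopic.Quotient.eq]
  exact ⟨fun h => eq_of_heq (Sigma.mk.inj h).2, fun h => congrArg (Sigma.mk y) h⟩

/-- Precomposition with loops is a left action because `Pi1` multiplies in order of traversal. -/
instance : MulAction (Pi1 Y b) (PathsFrom Y b) where
  smul s e := ⟨e.1, Path.Homotopic.Quotient.trans (FundamentalGroup.toPath s.unop) e.2⟩
  one_smul e := Sigma.ext rfl (heq_of_eq (Path.Homotopic.Quotient.refl_trans e.2))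
  mul_smul _ _ _ := Sigma.ext rfl (heq_of_eq (Path.Homotopic.Quotient.trans_assoc _ _ _))

theorem smul_mk (p : Path b b) {y : Y} (q : Path b y) :
    Pi1.mk p • mk q = mk (p.trans q) := rfl

end PathsFrom

theorem Pi1.mk_surjective {Y : Type u} [TopologicalSpace Y] {b : Y} (s : Pi1 Y b) :
    ∃ p, Pi1.mk p = s := by
  obtain ⟨p, hp⟩ := Path.Homotopic.Quotient.mk_surjective (FundamentalGroup.toPath s.unop)
  exact ⟨p, congrArg MulOpposite.op hp⟩

theorem Pi1.mk_eq_of_homotopic {Y : Type u} [TopologicalSpace Y] {b : Y} {p q : Path b b}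
    (h : p.Homotopic q) : Pi1.mk p = Pi1.mk q :=
  congrArg MulOpposite.op (Path.Homotopic.Quotient.eq.2 h)

theorem Pi1.mk_refl {Y : Type u} [TopologicalSpace Y] {b : Y} : Pi1.mk (Path.refl b) = 1 := rfl

theorem trans_apply_congr {Y : Type*} [TopologicalSpace Y] {y z w y' z' w' : Y}
    {p : Path y z} {q : Path z w} {p' : Path y' z'} {q' : Path z' w'}
    (hp : ∀ t, p t = p' t) (hq : ∀ t, q t = q' t) (t : unitInterval) :
    p.trans q t = p'.trans q' t := by
  rw [Path.trans_apply, Path.trans_apply]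
  split_ifs
  · exact hp _
  · exact hq _

section

variable (X : SSet.{u}) (x : X _⦋0⦌) (hx : ∀ y : X _⦋0⦌, y = x)

include hx

theorem simplexMap_vertex {n : ℕ} (σ : X _⦋n⦌) (i : Fin (n + 1)) :
    simplexMap X σ (stdSimplex.vertex i) = vertexPoint X x := by
  rw [vertexPoint, ← hx (X.map (SimplexCategory.const ⦋0⦌ ⦋n⦌ i).op σ), simplexMap_map]
  rw [Subsingleton.elim (default : stdSimplex ℝ (Fin (0 + 1))) (stdSimplex.vertex 0),
    stdSimplex.map_vertex]
  rfl

/-- Simplices are simply connected, so the straight edge may be replaced by any path in the simplex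
with the same endpoints. -/
theorem edgeClass_edge {n : ℕ} (σ : X _⦋n⦌) (j : Fin (n + 1))
    (c : Path (stdSimplex.vertex (S := ℝ) (0 : Fin (n + 1))) (stdSimplex.vertex j)) :
    edgeClass X x hx (edge X σ (Fin.zero_le j)) =
      Pi1.mk ((c.map (simplexMap X σ).continuous).cast (simplexMap_vertex X x hx σ 0).symm
        (simplexMap_vertex X x hx σ j).symm) := by
  let f : ⦋1⦌ ⟶ ⦋n⦌ := SimplexCategory.mkOfLe 0 j (Fin.zero_le j)
  have hs : stdSimplexHomeomorphUnitInterval.symm 0 = stdSimplex.vertex (S := ℝ) (0 : Fin 2) := by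
    rw [Homeomorph.symm_apply_eq]
    rfl
  have ht : stdSimplexHomeomorphUnitInterval.symm 1 = stdSimplex.vertex (S := ℝ) (1 : Fin 2) := by
    rw [Homeomorph.symm_apply_eq]
    rfl
  let d : Path (stdSimplex.vertex (S := ℝ) (0 : Fin (n + 1))) (stdSimplex.vertex j) :=
    { toFun := fun t => stdSimplex.map f (stdSimplexHomeomorphUnitInterval.symm t)
      continuous_toFun := (stdSimplex.continuous_map f).comp
        stdSimplexHomeomorphUnitInterval.symm.continuous
      source' := by
        change stdSimplex.map f (stdSimplexHomeomorphUnitInterval.symm 0) = _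
        rw [hs]
        exact stdSimplex.map_vertex _ _
      target' := by
        change stdSimplex.map f (stdSimplexHomeomorphUnitInterval.symm 1) = _
        rw [ht]
        exact stdSimplex.map_vertex _ _ }
  have hdc : d.Homotopic c := SimplyConnectedSpace.paths_homotopic _ _
  rw [← Pi1.mk_eq_of_homotopic ((hdc.map (simplexMap X σ)).pathCast
    (simplexMap_vertex X x hx σ 0).symm (simplexMap_vertex X x hx σ j).symm), edgeClass]
  congr 1
  ext t
  exact simplexMap_map X f σ _

/-- The class of a path inside of a simplex from its initial vertex to a given point. -/
def star {n : ℕ} (σ : X _⦋n⦌) (v : stdSimplex ℝ (Fin (n + 1))) :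
    PathsFrom |X| (vertexPoint X x) :=
  PathsFrom.mk (((PathConnectedSpace.somePath (stdSimplex.vertex 0) v).map
    (simplexMap X σ).continuous).cast (simplexMap_vertex X x hx σ 0).symm rfl)

theorem star_eq {n : ℕ} (σ : X _⦋n⦌) {v : stdSimplex ℝ (Fin (n + 1))}
    (c : Path (stdSimplex.vertex 0) v) : star X x hx σ v =
      PathsFrom.mk ((c.map (simplexMap X σ).continuous).cast
        (simplexMap_vertex X x hx σ 0).symm rfl) :=
  PathsFrom.mk_eq_iff.2 (((SimplyConnectedSpace.paths_homotopic _ c).map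
    (simplexMap X σ)).pathCast _ _)

/-- Both sides come from paths in the simplex `σ` from vertex `0` to the same point, the left one
passing through vertex `f 0`; simple connectivity makes them homotopic. Hence `star` descends to
`|X|` modulo edge classes. -/
theorem edgeClass_smul_star {m n : ℕ} (f : ⦋m⦌ ⟶ ⦋n⦌) (σ : X _⦋n⦌)
    (v : stdSimplex ℝ (Fin (m + 1))) :
    edgeClass X x hx (edge X σ (Fin.zero_le (f.toOrderHom 0))) • star X x hx (X.map f.op σ) v =
      star X x hx σ (stdSimplex.map f v) := by
  let c := PathConnectedSpace.somePath (stdSimplex.vertex (S := ℝ) (0 : Fin (n + 1)))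
    (stdSimplex.vertex (f.toOrderHom 0))
  let d := PathConnectedSpace.somePath (stdSimplex.vertex (S := ℝ) (0 : Fin (m + 1))) v
  have hf : stdSimplex.vertex (S := ℝ) (f.toOrderHom 0) =
      stdSimplex.map f (stdSimplex.vertex (0 : Fin (m + 1))) := (stdSimplex.map_vertex _ _).symm
  rw [edgeClass_edge X x hx σ _ c, star_eq X x hx _ d, PathsFrom.smul_mk,
    star_eq X x hx σ (c.trans ((d.map (stdSimplex.continuous_map f)).cast hf rfl))]
  refine PathsFrom.mk_congr fun t => ?_
  rw [Path.map_trans, Path.cast_coe]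
  refine trans_apply_congr (fun t => ?_) (fun t => ?_) t
  · rfl
  · exact simplexMap_map X f σ (d t)

/-- The fundamental group of the geometric realization of a simplicial set with a single vertex is
generated by the classes of edges. -/
theorem closure_range_edgeClass :
    Subgroup.closure (Set.range (edgeClass X x hx)) = ⊤ := by
  set S := Subgroup.closure (Set.range (edgeClass X x hx)) with hS
  let b := vertexPoint X x
  let cls : PathsFrom |X| b → MulAction.orbitRel.Quotient S (PathsFrom |X| b) := Quotient.mk _
  have cls_eq : ∀ {e e'}, cls e = cls e' ↔ ∃ s ∈ S, s • e' = e := fun {e e'} => by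
    refine Quotient.eq''.trans ⟨?_, ?_⟩
    · rintro ⟨s, hs⟩
      exact ⟨s, s.2, hs⟩
    · rintro ⟨s, hs, h⟩
      exact ⟨⟨s, hs⟩, h⟩
  -- Modulo `S` the class of `star` depends only on the point of `|X|`. Thus `g` chooses, for every
  -- point, a class of paths to it modulo `S`.
  obtain ⟨g, hg⟩ := exists_fun_desc X (fun n σ v => cls (star X x hx σ v)) fun m n f σ v =>
    (cls_eq.2 ⟨_, Subgroup.subset_closure ⟨_, rfl⟩, edgeClass_smul_star X x hx f σ v⟩).symm
  -- The property says that prolonging by `p` carries the value of `g` at its start to the value at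
  -- its end.
  let P : ∀ ⦃y z : |X|⦄, Path y z → Prop := fun y z p =>
    ∀ e : Path b y, g y = cls (PathsFrom.mk e) → g z = cls (PathsFrom.mk (e.trans p))
  have hP : ∀ {y z : |X|} (p : Path y z), P p := by
    refine path_induction X P ?_ ?_ ?_
    · intro y z p q hpq hp e he
      rw [hp e he]
      congr 1
      exact PathsFrom.mk_eq_iff.2 ((Path.Homotopic.refl e).hcomp hpq)
    · intro y z w p q hp hq e he
      rw [hq _ (hp e he)]
      congr 1
      exact PathsFrom.mk_eq_iff.2 ⟨Path.Homotopy.transAssoc e p q⟩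
    · intro n σ v w c e he
      rw [hg, cls_eq] at he
      obtain ⟨s, hs, h⟩ := he
      obtain ⟨l, rfl⟩ := Pi1.mk_surjective s
      let d := PathConnectedSpace.somePath (stdSimplex.vertex (S := ℝ) (0 : Fin (n + 1))) v
      rw [hg, cls_eq]
      refine ⟨_, hs, ?_⟩
      rw [star_eq X x hx σ d, PathsFrom.smul_mk, PathsFrom.mk_eq_iff] at h
      rw [PathsFrom.smul_mk, star_eq X x hx σ (d.trans c)]
      have h1 : PathsFrom.mk (l.trans (e.trans (c.map (simplexMap X σ).continuous))) =
          PathsFrom.mk ((l.trans e).trans (c.map (simplexMap X σ).continuous)) :=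
        PathsFrom.mk_eq_iff.2 (Path.Homotopic.symm ⟨Path.Homotopy.transAssoc _ _ _⟩)
      rw [h1, PathsFrom.mk_eq_iff.2 (h.hcomp (Path.Homotopic.refl _))]
      refine PathsFrom.mk_congr fun t => ?_
      rw [Path.map_trans, Path.cast_coe]
      exact trans_apply_congr (fun t => rfl) (fun t => rfl) t
  have hbase : g b = cls (PathsFrom.mk (Path.refl b)) := by
    have h0 : g b = _ := hg 0 x default
    rw [h0]
    congr 1
    refine PathsFrom.mk_congr fun t => ?_
    change simplexMap X x _ = simplexMap X x default
    congr 1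
    exact Subsingleton.elim _ _
  rw [eq_top_iff]
  intro s _
  obtain ⟨p, rfl⟩ := Pi1.mk_surjective s
  -- For a loop `p` both values are `g b`, so `p` and the constant path agree modulo `S`.
  have h := hP p _ hbase
  rw [hbase, cls_eq] at h
  obtain ⟨s, hs, h⟩ := h
  obtain ⟨l, rfl⟩ := Pi1.mk_surjective s
  rw [PathsFrom.smul_mk, PathsFrom.mk_eq_iff] at h
  have h2 := Pi1.mk_eq_of_homotopic h
  rw [← Pi1.mk_mul_mk, ← Pi1.mk_mul_mk, Pi1.mk_refl, one_mul] at h2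
  rw [eq_inv_of_mul_eq_one_right h2]
  exact S.inv_mem hs

end

/-! ### The relations given by triangles -/

theorem star_vertex (X : SSet.{u}) (x : X _⦋0⦌) (hx : ∀ y : X _⦋0⦌, y = x) {n : ℕ} (σ : X _⦋n⦌)
    (j : Fin (n + 1)) : star X x hx σ (stdSimplex.vertex j) =
      edgeClass X x hx (edge X σ (Fin.zero_le j)) • PathsFrom.mk (Path.refl (vertexPoint X x)) := by
  let c := PathConnectedSpace.somePath (stdSimplex.vertex (S := ℝ) (0 : Fin (n + 1)))
    (stdSimplex.vertex j)
  rw [star_eq X x hx σ c, edgeClass_edge X x hx σ j c, PathsFrom.smul_mk,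
    PathsFrom.mk_eq_iff.2 ⟨Path.Homotopy.transRefl _⟩]
  exact PathsFrom.mk_congr fun t => rfl

theorem Pi1.smul_mk_refl_injective {Y : Type u} [TopologicalSpace Y] {b : Y} {s t : Pi1 Y b}
    (h : s • PathsFrom.mk (Path.refl b) = t • PathsFrom.mk (Path.refl b)) : s = t := by
  obtain ⟨p, rfl⟩ := Pi1.mk_surjective s
  obtain ⟨q, rfl⟩ := Pi1.mk_surjective t
  rw [PathsFrom.smul_mk, PathsFrom.smul_mk, PathsFrom.mk_eq_iff] at h
  have := Pi1.mk_eq_of_homotopic h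
  rwa [← Pi1.mk_mul_mk, ← Pi1.mk_mul_mk, Pi1.mk_refl, mul_one, mul_one] at this

theorem edge_two (X : SSet.{u}) (t : X _⦋2⦌) :
    edge X t (Fin.zero_le 1) = X.δ 2 t ∧ edge X t (Fin.zero_le 2) = X.δ 1 t := by
  unfold edge SimplicialObject.δ
  constructor
  all_goals
    congr 4
    exact SimplexCategory.Hom.ext_one_left _ _

/-- A triangle gives a relation in the fundamental group. -/
theorem edgeClass_triangle (X : SSet.{u}) (x : X _⦋0⦌) (hx : ∀ y : X _⦋0⦌, y = x) (t : X _⦋2⦌) :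
    edgeClass X x hx (X.δ 1 t) = edgeClass X x hx (X.δ 2 t) * edgeClass X x hx (X.δ 0 t) := by
  refine Pi1.smul_mk_refl_injective ?_
  -- The face `δ 0` has vertices `1, 2`; the identity compares the edges `01` and `12` traversed in
  -- succession with a direct path from `0` to `2`.
  have h := edgeClass_smul_star X x hx (SimplexCategory.δ (0 : Fin 3)) t (stdSimplex.vertex 1)
  rw [star_vertex, stdSimplex.map_vertex, edge_zero_one] at h
  have h2 := star_vertex X x hx t 2
  rw [(edge_two X t).2] at h2
  rw [mul_smul, ← h2, ← (edge_two X t).1]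
  exact h.symm

/-! ### The augmentation ideal -/

/-- The identities `ab - 1 = a(b - 1) + (a - 1)` and `a⁻¹ - 1 = -a⁻¹(a - 1)` show that even the left
ideal suffices. -/
theorem of_sub_one_mem_span {G : Type u} [Group G] {s : Set G} (hs : Subgroup.closure s = ⊤)
    (g : G) : MonoidAlgebra.of ℤ G g - 1 ∈
      Ideal.span ((fun a => MonoidAlgebra.of ℤ G a - 1) '' s) := by
  have hg : g ∈ Subgroup.closure s := hs ▸ Subgroup.mem_top g
  induction hg using Subgroup.closure_induction with
  | mem a ha => exact Ideal.subset_span ⟨a, ha, rfl⟩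
  | one => rw [map_one, sub_self]; exact zero_mem _
  | mul a b _ _ ha hb =>
    have h : MonoidAlgebra.of ℤ G (a * b) - 1 =
        MonoidAlgebra.of ℤ G a * (MonoidAlgebra.of ℤ G b - 1) + (MonoidAlgebra.of ℤ G a - 1) := by
      rw [map_mul]
      noncomm_ring
    rw [h]
    exact add_mem (Ideal.mul_mem_left _ _ hb) ha
  | inv a _ ha =>
    have h : MonoidAlgebra.of ℤ G a⁻¹ - 1 =
        -(MonoidAlgebra.of ℤ G a⁻¹) * (MonoidAlgebra.of ℤ G a - 1) := by
      rw [mul_sub, neg_mul, ← map_mul, inv_mul_cancel, map_one]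
      noncomm_ring
    rw [h]
    exact Ideal.mul_mem_left _ _ ha

theorem of_sub_one_mem_augIdeal {G : Type u} [Group G] (g : G) :
    MonoidAlgebra.of ℤ G g - 1 ∈ augIdeal G := by
  change MonoidAlgebra.lift ℤ ℤ G (1 : G →* ℤ) _ = 0
  rw [map_sub, MonoidAlgebra.lift_of, MonoidHom.one_apply, map_one (MonoidAlgebra.lift ℤ ℤ G _),
    sub_self]

/-- Subtracting its augmentation from an element leaves an integral combination of elements `g - 1`.
-/
theorem augIdeal_le_span {G : Type u} [Group G] {s : Set G} (hs : Subgroup.closure s = ⊤) :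
    augIdeal G ≤ Ideal.span ((fun a => MonoidAlgebra.of ℤ G a - 1) '' s) := by
  have key : ∀ w : MonoidAlgebra ℤ G,
      w - algebraMap ℤ _ (MonoidAlgebra.lift ℤ ℤ G (1 : G →* ℤ) w) ∈
        Ideal.span ((fun a => MonoidAlgebra.of ℤ G a - 1) '' s) := fun w => by
    induction w using MonoidAlgebra.induction_on with
    | of g =>
      rw [MonoidAlgebra.lift_of, MonoidHom.one_apply, map_one]
      exact of_sub_one_mem_span hs g
    | add a b ha hb =>
      rw [map_add, map_add, add_sub_add_comm]
      exact add_mem ha hb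
    | smul r a ha =>
      rw [map_smul, smul_eq_mul, map_mul, ← Algebra.smul_def, ← smul_sub, Algebra.smul_def]
      exact Ideal.mul_mem_left _ _ ha
  intro w hw
  have h := key w
  have hw' : MonoidAlgebra.lift ℤ ℤ G (1 : G →* ℤ) w = 0 := hw
  rwa [hw', map_zero, sub_zero] at h

/-- A ring homomorphism from a group ring maps the powers of the augmentation ideal to the left
ideals spanned by products of the images of `a - 1`, for generators `a`. -/
theorem map_mem_of_mem_augIdeal_pow {G : Type u} [Group G] {s : Set G}
    (hs : Subgroup.closure s = ⊤) {A : Type u} [Ring A] (Θ : MonoidAlgebra ℤ G →+* A) (k : ℕ)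
    {w : MonoidAlgebra ℤ G} (hw : w ∈ augIdeal G ^ k) :
    Θ w ∈ Ideal.span {z | ∃ l : List G, l.length = k ∧ (∀ a ∈ l, a ∈ s) ∧
      (l.map fun a => Θ (MonoidAlgebra.of ℤ G a) - 1).prod = z} := by
  induction k generalizing w with
  | zero =>
    have h1 : (1 : A) ∈ Ideal.span {z | ∃ l : List G, l.length = 0 ∧ (∀ a ∈ l, a ∈ s) ∧
      (l.map fun a => Θ (MonoidAlgebra.of ℤ G a) - 1).prod = z} :=
      Ideal.subset_span ⟨[], rfl, by simp, by simp⟩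
    rw [← mul_one (Θ w)]
    exact Ideal.mul_mem_left _ _ h1
  | succ k ih =>
    rw [Submodule.pow_succ] at hw
    induction hw using Submodule.mul_induction_on' with
    | mem_mul_mem m hm n hn =>
      replace hn := augIdeal_le_span hs hn
      -- The factor `m` varies because a left coefficient of `n` is absorbed into it; this stays in
      -- the `k`-th power, which is two-sided.
      induction hn using Submodule.span_induction generalizing m with
      | mem n hn =>
        obtain ⟨a, ha, rfl⟩ := hn
        have hm' := ih hm
        rw [map_mul]
        generalize Θ m = z at hm'
        induction hm' using Submodule.span_induction with
        | mem z hz =>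
          obtain ⟨l, hl, hls, rfl⟩ := hz
          refine Ideal.subset_span ⟨l ++ [a], by simp [hl], ?_, by simp⟩
          intro b hb
          rcases List.mem_append.1 hb with hb | hb
          · exact hls b hb
          · exact List.mem_singleton.1 hb ▸ ha
        | zero => simp
        | add z z' _ _ hz hz' => rw [add_mul]; exact add_mem hz hz'
        | smul r z _ hz => rw [smul_eq_mul, mul_assoc]; exact Ideal.mul_mem_left _ _ hz
      | zero => simp
      | add n n' _ _ hn hn' => rw [mul_add, map_add]; exact add_mem (hn m hm) (hn' m hm)
      | smul r n _ hn =>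
        rw [smul_eq_mul, ← mul_assoc]
        exact hn (m * r) (Ideal.mul_mem_right _ _ hm)
    | add x _ y _ hx hy =>
      rw [map_add]
      exact add_mem hx hy

/-! ### The ring `A^(k)(X)` -/

/-- Only the middle term of the comultiplication survives in `C̄`, so `∂[t] = -[d₀t] + [d₁t] - [d₂t]
- [d₂t|d₀t]`; completing the product gives the stated form. -/
theorem cobarD_gen_triangle (X : SSet.{u}) (t : X _⦋2⦌) :
    cobarD X (gen X t) =
      (1 + gen X (X.δ 1 t)) - (1 + gen X (X.δ 2 t)) * (1 + gen X (X.δ 0 t)) := by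
  have hfront : gen X (frontFace X t 1) = gen X (X.δ 2 t) := by
    have : (frontFace X t 1 : X _⦋1⦌) = X.δ 2 t := by
      unfold frontFace SimplicialObject.δ
      congr 4
      exact SimplexCategory.Hom.ext_one_left _ _
    exact congrArg (gen X) this
  have hback : gen X (backFace X t 1) = gen X (X.δ 0 t) := by
    have : (backFace X t 1 : X _⦋1⦌) = X.δ 0 t := by
      unfold backFace SimplicialObject.δ
      congr 4
    exact congrArg (gen X) this
  have h0 : gen X (frontFace X t 0) = 0 := by
    rw [gen, redSimplex_zero X rfl, map_zero]
  have h2 : gen X (backFace X t 2) = 0 := by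
    rw [gen, redSimplex_zero X rfl, map_zero]
  rw [cobarD_gen, redBoundary_redSimplex, Fin.sum_univ_three, Fin.sum_univ_three, h0, h2, hfront,
    hback]
  have hbr : ∀ a : X _⦋1⦌, bracket X (redSimplex X a) = gen X a := fun _ => rfl
  simp only [map_add, map_smul, hbr]
  simp
  noncomm_ring

theorem cobarD_list_prod_of_sum_eq_zero (X : SSet.{u}) (l : List (Σ m : ℕ, X _⦋m + 1⦌))
    (hl : (l.map fun s => s.1).sum = 0) : cobarD X (l.map fun s => gen X s.2).prod = 0 := by
  induction l with
  | nil => simp [cobarD_one]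
  | cons s l ih =>
    obtain ⟨m, a⟩ := s
    simp only [List.map_cons, List.sum_cons, Nat.add_eq_zero_iff] at hl
    obtain ⟨rfl, hl⟩ := hl
    rw [List.map_cons, List.prod_cons, cobarD_mul, ih hl, mul_zero, add_zero]
    simp only
    rw [cobarD_gen_edge X a, zero_mul]

/-- The cycle `1 + [a]` minus one is the generator `[a]`. -/
theorem oneAddEdge_sub_one_coe (X : SSet.{u}) (k : ℕ) (a : X _⦋1⦌) :
    ((oneAddEdge X k a - 1 : zeroCycles X k) : TruncCobar X k) = toTrunc X k (gen X a) := by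
  change toTrunc X k (1 + gen X a) - 1 = _
  rw [map_add, map_one, add_sub_cancel_left]

theorem list_prod_gen_mem (X : SSet.{u}) (l : List (X _⦋1⦌)) :
    (l.map fun a => gen X a).prod ∈ lengthIdeal X l.length := by
  refine Ideal.subset_span ?_
  induction l with
  | nil => exact Submodule.one_le.1 le_rfl
  | cons a l ih =>
    rw [List.map_cons, List.prod_cons, List.length_cons, pow_succ']
    exact Submodule.mul_mem_mul ⟨_, rfl⟩ ih

/-- Each factor is the class of `[a]`, and a word of `k` brackets lies in the ideal divided out. -/
theorem list_prod_edge_eq_zero (X : SSet.{u}) (k : ℕ) (l : List (X _⦋1⦌)) (hl : l.length = k) :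
    (l.map fun a => AQuot.mk X k (oneAddEdge X k a) - 1).prod = 0 := by
  have h : (l.map fun a => oneAddEdge X k a - 1).prod = 0 := by
    refine Subtype.ext ?_
    rw [← Subring.coe_subtype, map_list_prod, List.map_map]
    have : (⇑(zeroCycles X k).subtype ∘ fun a => oneAddEdge X k a - 1) =
        ⇑(toTrunc X k) ∘ fun a => gen X a := funext fun a => oneAddEdge_sub_one_coe X k a
    rw [this, ← List.map_map, ← map_list_prod]
    exact Ideal.Quotient.eq_zero_iff_mem.2 (hl ▸ list_prod_gen_mem X l)
  have h2 := congrArg (AQuot.mk X k) h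
  have h3 : AQuot.mk X k (l.map fun a => oneAddEdge X k a - 1).prod =
      (l.map fun a => AQuot.mk X k (oneAddEdge X k a) - 1).prod := by
    change Ideal.Quotient.mk (zeroBoundaries X k) _ = _
    rw [map_list_prod, List.map_map]
    rfl
  rw [← h3, h2]
  exact map_zero (Ideal.Quotient.mk (zeroBoundaries X k))

/-- The element `[a]` is nilpotent of exponent `k`. This is what allows `1 + [a]` to be the value of
a cocycle in a group. -/
theorem isUnit_mk_oneAddEdge (X : SSet.{u}) (k : ℕ) (a : X _⦋1⦌) :
    IsUnit (AQuot.mk X k (oneAddEdge X k a)) := by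
  have h : IsNilpotent (AQuot.mk X k (oneAddEdge X k a) - 1) := by
    refine ⟨k, ?_⟩
    have := list_prod_edge_eq_zero X k (List.replicate k a) (List.length_replicate)
    rwa [List.map_replicate, List.prod_replicate] at this
  have h2 := h.isUnit_one_add
  rwa [add_sub_cancel] at h2

theorem mk_oneAddEdge_triangle (X : SSet.{u}) (k : ℕ) (t : X _⦋2⦌) :
    AQuot.mk X k (oneAddEdge X k (X.δ 1 t)) =
      AQuot.mk X k (oneAddEdge X k (X.δ 2 t)) * AQuot.mk X k (oneAddEdge X k (X.δ 0 t)) := by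
  change Ideal.Quotient.mk (zeroBoundaries X k) _ = Ideal.Quotient.mk (zeroBoundaries X k) _ *
    Ideal.Quotient.mk (zeroBoundaries X k) _
  rw [← map_mul, Ideal.Quotient.eq]
  refine ⟨toTrunc X k (gen X t), toTrunc_mem X k (gen_mem_cobarDegree X t), ?_⟩
  rw [truncD_toTrunc, cobarD_gen_triangle, map_sub, map_mul]
  rfl

/-- A word of degree `0` involves only edges, and `[a] = (1 + [a]) - 1`. -/
theorem mem_closure_oneAddEdge (X : SSet.{u}) (k : ℕ) (z : zeroCycles X k) :
    z ∈ Subring.closure (Set.range (oneAddEdge X k)) := by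
  suffices h : ∀ w ∈ cobarDegree X 0, ∃ z ∈ Subring.closure (Set.range (oneAddEdge X k)),
      (z : TruncCobar X k) = toTrunc X k w by
    obtain ⟨w, hw, hwz⟩ := z.2.1
    obtain ⟨z', hz', e⟩ := h w hw
    have : z = z' := Subtype.ext (hwz.symm.trans e.symm)
    rwa [this]
  intro w hw
  induction hw using Submodule.span_induction with
  | mem w hw =>
    obtain ⟨l, hl, rfl⟩ := hw
    induction l with
    | nil => exact ⟨1, one_mem _, by simp⟩
    | cons s l ih =>
      obtain ⟨m, a⟩ := s
      simp only [List.map_cons, List.sum_cons, Nat.add_eq_zero_iff] at hl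
      obtain ⟨rfl, hl⟩ := hl
      obtain ⟨z, hz, e⟩ := ih hl
      refine ⟨(oneAddEdge X k a - 1) * z,
        mul_mem (sub_mem (Subring.subset_closure ⟨a, rfl⟩) (one_mem _)) hz, ?_⟩
      rw [Subring.coe_mul, e, oneAddEdge_sub_one_coe, List.map_cons, List.prod_cons, map_mul]
  | zero => exact ⟨0, zero_mem _, (map_zero _).symm⟩
  | add v w _ _ hv hw =>
    obtain ⟨z, hz, e⟩ := hv
    obtain ⟨z', hz', e'⟩ := hw
    exact ⟨z + z', add_mem hz hz', by rw [Subring.coe_add, e, e', map_add]⟩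
  | smul r w _ hw =>
    obtain ⟨z, hz, e⟩ := hw
    exact ⟨r • z, zsmul_mem hz r, by rw [map_zsmul, ← e]; rfl⟩

/-! ### The two homomorphisms -/

section

variable (X : SSet.{u}) (x : X _⦋0⦌) (hx : ∀ y : X _⦋0⦌, y = x) (k : ℕ)

include hx in
/-- The homomorphism from the group ring sends `g_a` to the class of `1 + [a]`. -/
theorem exists_hom_DQuot : ∃ Θ : DQuot (Pi1 |X| (vertexPoint X x)) k →+* AQuot X k,
    ∀ a, Θ (DQuot.of k (edgeClass X x hx a)) = AQuot.mk X k (oneAddEdge X k a) := by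
  -- The target group is the unit group of `A^(k)(X)`; the cocycle condition holds because `∂[t]` is
  -- a boundary.
  obtain ⟨Φ, hΦ⟩ := exists_hom_of_cocycle X x hx
    (fun a => (isUnit_mk_oneAddEdge X k a).unit) (fun t => Units.ext (mk_oneAddEdge_triangle X k t))
  let Θ : MonoidAlgebra ℤ (Pi1 |X| (vertexPoint X x)) →+* AQuot X k :=
    (MonoidAlgebra.lift ℤ (AQuot X k) _ ((Units.coeHom _).comp Φ)).toRingHom
  have hΘ : ∀ g, Θ (MonoidAlgebra.of ℤ _ g) = Φ g := fun g => MonoidAlgebra.lift_of _ _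
  have hΘa : ∀ a, Θ (MonoidAlgebra.of ℤ _ (edgeClass X x hx a)) =
      AQuot.mk X k (oneAddEdge X k a) := fun a => by
    rw [hΘ, hΦ]
    rfl
  have hker : ∀ w ∈ augIdeal (Pi1 |X| (vertexPoint X x)) ^ k, Θ w = 0 := fun w hw => by
    have h := map_mem_of_mem_augIdeal_pow (closure_range_edgeClass X x hx) Θ k hw
    refine Ideal.mem_bot.1 ((Ideal.span_eq_bot.2 ?_).le h)
    rintro _ ⟨l, hl, hls, rfl⟩
    have hex : ∃ l' : List (X _⦋1⦌), l'.map (edgeClass X x hx) = l := by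
      rw [← Set.mem_range, Set.range_list_map]
      exact hls
    obtain ⟨l', rfl⟩ := hex
    rw [List.map_map]
    have : ((fun a => Θ (MonoidAlgebra.of ℤ _ a) - 1) ∘ edgeClass X x hx) =
        fun a => AQuot.mk X k (oneAddEdge X k a) - 1 := funext fun a => by
      simp only [Function.comp_apply, hΘa]
    rw [this]
    exact list_prod_edge_eq_zero X k l' (by simpa using hl)
  exact ⟨Ideal.Quotient.lift _ Θ hker, hΘa⟩

/-! ### From the cobar construction to the group ring -/

/-- The value on a simplex of the homomorphism from the cobar construction to the group ring. -/
def simplexVal (s : Σ n : ℕ, X _⦋n⦌) : MonoidAlgebra ℤ (Pi1 |X| (vertexPoint X x)) :=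
  match s with
  | ⟨1, a⟩ => MonoidAlgebra.of ℤ _ (edgeClass X x hx a) - 1
  | ⟨_, _⟩ => 0

theorem simplexVal_mem (s : Σ n : ℕ, X _⦋n⦌) :
    simplexVal X x hx s ∈ augIdeal (Pi1 |X| (vertexPoint X x)) := by
  unfold simplexVal
  split
  · exact of_sub_one_mem_augIdeal _
  · exact zero_mem _

/-- The linear map on reduced chains with `a ↦ g_a - 1` on edges. -/
def chainVal : RedChains X →ₗ[ℤ] MonoidAlgebra ℤ (Pi1 |X| (vertexPoint X x)) :=
  (zeroChains X).liftQ (Finsupp.linearCombination ℤ (simplexVal X x hx)) <| by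
    refine Submodule.span_le.2 ?_
    rintro _ ⟨y, rfl⟩
    change Finsupp.linearCombination ℤ (simplexVal X x hx) (simplexChain X y) = 0
    rw [simplexChain, Finsupp.linearCombination_single, one_smul]
    rfl

theorem chainVal_redSimplex {n : ℕ} (σ : X _⦋n⦌) :
    chainVal X x hx (redSimplex X σ) = simplexVal X x hx ⟨n, σ⟩ := by
  change Finsupp.linearCombination ℤ (simplexVal X x hx) (simplexChain X σ) = _
  rw [simplexChain, Finsupp.linearCombination_single, one_smul]

theorem chainVal_mem (c : RedChains X) :
    chainVal X x hx c ∈ augIdeal (Pi1 |X| (vertexPoint X x)) := by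
  obtain ⟨c, rfl⟩ := (zeroChains X).mkQ_surjective c
  change Finsupp.linearCombination ℤ (simplexVal X x hx) c ∈ _
  rw [Finsupp.linearCombination_apply]
  exact sum_mem fun s _ => zsmul_mem (simplexVal_mem X x hx s) _

/-- The algebra homomorphism from the cobar construction to the group ring. -/
def cobarVal : Cobar X →ₐ[ℤ] MonoidAlgebra ℤ (Pi1 |X| (vertexPoint X x)) :=
  TensorAlgebra.lift ℤ (chainVal X x hx)

theorem cobarVal_bracket (c : RedChains X) :
    cobarVal X x hx (bracket X c) = chainVal X x hx c :=
  TensorAlgebra.lift_ι_apply _ _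

theorem cobarVal_edge (a : X _⦋1⦌) : cobarVal X x hx (gen X a) =
    MonoidAlgebra.of ℤ _ (edgeClass X x hx a) - 1 := by
  rw [gen, cobarVal_bracket, chainVal_redSimplex]
  rfl

theorem cobarVal_mem_of_mem_lengthIdeal {w : Cobar X} (hw : w ∈ lengthIdeal X k) :
    cobarVal X x hx w ∈ augIdeal (Pi1 |X| (vertexPoint X x)) ^ k := by
  induction hw using Submodule.span_induction with
  | mem w hw =>
    induction k generalizing w with
    | zero => rw [Submodule.pow_zero, Ideal.one_eq_top]; trivial
    | succ k ih =>
      rw [SetLike.mem_coe, pow_succ] at hw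
      rw [Submodule.pow_succ]
      induction hw using Submodule.mul_induction_on' with
      | mem_mul_mem m hm n hn =>
        obtain ⟨c, rfl⟩ := hn
        rw [map_mul, cobarVal_bracket]
        exact Ideal.mul_mem_mul (ih m hm) (chainVal_mem X x hx c)
      | add v _ w _ hv hw => rw [map_add]; exact add_mem hv hw
  | zero => rw [map_zero]; exact zero_mem _
  | add v w _ _ hv hw => rw [map_add]; exact add_mem hv hw
  | smul r w _ hw => rw [smul_eq_mul, map_mul]; exact Ideal.mul_mem_left _ _ hw

theorem cobarVal_cobarD_triangle (t : X _⦋2⦌) : cobarVal X x hx (cobarD X (gen X t)) = 0 := by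
  rw [cobarD_gen_triangle, map_sub, map_mul, map_add, map_add, map_add, map_one, cobarVal_edge,
    cobarVal_edge, cobarVal_edge, add_sub_cancel, add_sub_cancel, add_sub_cancel, ← map_mul,
    edgeClass_triangle, sub_self]

/-- A word of degree `1` has exactly one triangle among edges. Edges are cycles, so the Leibniz rule
leaves only the term with `∂` of the triangle, which maps to `0` by the triangle relation in `π₁`.
-/
theorem cobarVal_cobarD {w : Cobar X} (hw : w ∈ cobarDegree X 1) :
    cobarVal X x hx (cobarD X w) = 0 := by
  induction hw using Submodule.span_induction with
  | mem w hw =>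
    obtain ⟨l, hl, rfl⟩ := hw
    induction l with
    | nil => simp at hl
    | cons s l ih =>
      obtain ⟨m, a⟩ := s
      simp only [List.map_cons, List.sum_cons] at hl
      rw [List.map_cons, List.prod_cons, cobarD_mul, map_add, map_mul, map_mul]
      rcases Nat.eq_zero_or_pos m with rfl | hm
      · rw [ih (by omega), mul_zero, add_zero]
        simp only
        rw [cobarD_gen_edge X a, map_zero, zero_mul]
      · obtain rfl : m = 1 := by omega
        rw [cobarD_list_prod_of_sum_eq_zero X l (by omega), map_zero, mul_zero, add_zero]
        simp only
        rw [cobarVal_cobarD_triangle X x hx a, zero_mul]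
  | zero => rw [map_zero, map_zero]
  | add v w _ _ hv hw => rw [map_add, map_add, hv, hw, add_zero]
  | smul r w _ hw => rw [map_smul, map_smul, hw, smul_zero]

/-- The homomorphism from `A^(k)(X)` sends the class of `1 + [a]` to `g_a`. -/
theorem exists_hom_AQuot : ∃ Ψ : AQuot X k →+* DQuot (Pi1 |X| (vertexPoint X x)) k,
    ∀ a, Ψ (AQuot.mk X k (oneAddEdge X k a)) = DQuot.of k (edgeClass X x hx a) := by
  let π := Ideal.Quotient.mk (augIdeal (Pi1 |X| (vertexPoint X x)) ^ k)
  let Ψ₀ : TruncCobar X k →+* DQuot (Pi1 |X| (vertexPoint X x)) k :=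
    Ideal.Quotient.lift (lengthIdeal X k) (π.comp (cobarVal X x hx).toRingHom) fun w hw =>
      Ideal.Quotient.eq_zero_iff_mem.2 (cobarVal_mem_of_mem_lengthIdeal X x hx k hw)
  have hΨ₀ : ∀ w, Ψ₀ (toTrunc X k w) = π (cobarVal X x hx w) := fun w => rfl
  refine ⟨Ideal.Quotient.lift (zeroBoundaries X k) (Ψ₀.comp (zeroCycles X k).subtype) ?_,
    fun a => ?_⟩
  · rintro z ⟨w, ⟨w', hw', rfl⟩, h⟩
    change Ψ₀ z = 0
    rw [← h]
    change Ψ₀ (toTrunc X k (cobarD X w')) = 0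
    rw [hΨ₀, cobarVal_cobarD X x hx hw', map_zero]
  · change Ψ₀ (toTrunc X k (1 + gen X a)) = _
    rw [hΨ₀, map_add, map_one, cobarVal_edge, add_sub_cancel]
    rfl

end

end CobarPi

end

/-! ### The isomorphism -/

theorem mainTheorem7 (X : SSet.{u}) (x : X _⦋0⦌) (hx : ∀ y : X _⦋0⦌, y = x) (k : ℕ) :
    ∃ e : CobarPi.DQuot (CobarPi.Pi1 |X| (CobarPi.vertexPoint X x)) k ≃+* CobarPi.AQuot X k,
      ∀ a : X _⦋1⦌,
        e (CobarPi.DQuot.of k (CobarPi.edgeClass X x hx a)) =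
          CobarPi.AQuot.mk X k (CobarPi.oneAddEdge X k a) := by
  obtain ⟨Θ, hΘ⟩ := CobarPi.exists_hom_DQuot X x hx k
  obtain ⟨Ψ, hΨ⟩ := CobarPi.exists_hom_AQuot X x hx k
  have h1 : Ψ.comp Θ = RingHom.id _ := by
    refine Ideal.Quotient.ringHom_ext (MonoidAlgebra.ringHom_ext (fun r => ?_) fun g => ?_)
    · have : (MonoidAlgebra.single 1 r : MonoidAlgebra ℤ
          (CobarPi.Pi1 |X| (CobarPi.vertexPoint X x))) = (r : ℤ) := rfl
      rw [this, map_intCast, map_intCast]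
    · have hg : g ∈ Subgroup.closure (Set.range (CobarPi.edgeClass X x hx)) := by
        rw [CobarPi.closure_range_edgeClass]
        exact Subgroup.mem_top g
      change Ψ (Θ (CobarPi.DQuot.of k g)) = CobarPi.DQuot.of k g
      have hone : CobarPi.DQuot.of k (1 : CobarPi.Pi1 |X| (CobarPi.vertexPoint X x)) = 1 := by
        rw [CobarPi.DQuot.of, map_one, map_one]
      have hmul : ∀ a b : CobarPi.Pi1 |X| (CobarPi.vertexPoint X x),
          CobarPi.DQuot.of k (a * b) = CobarPi.DQuot.of k a * CobarPi.DQuot.of k b :=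
        fun a b => by rw [CobarPi.DQuot.of, map_mul, map_mul]; rfl
      induction hg using Subgroup.closure_induction with
      | mem a ha =>
        obtain ⟨a, rfl⟩ := ha
        rw [hΘ, hΨ]
      | one => rw [hone, map_one, map_one]
      | mul a b _ _ ha hb => rw [hmul, map_mul, map_mul, ha, hb]
      -- The image of `a⁻¹` under `Ψ ∘ Θ` is a left inverse of the image of `a`, hence equals its
      -- right inverse, the class of `a⁻¹`.
      | inv a _ ha =>
        have e1 : CobarPi.DQuot.of k a⁻¹ * CobarPi.DQuot.of k a = 1 := by
          rw [← hmul, inv_mul_cancel, hone]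
        have e2 : CobarPi.DQuot.of k a * CobarPi.DQuot.of k a⁻¹ = 1 := by
          rw [← hmul, mul_inv_cancel, hone]
        have e3 := congrArg (fun z => Ψ (Θ z)) e1
        simp only [map_mul, map_one, ha] at e3
        exact left_inv_eq_right_inv e3 e2
  have h2 : Θ.comp Ψ = RingHom.id _ := by
    refine Ideal.Quotient.ringHom_ext (RingHom.ext fun z => ?_)
    have hz := CobarPi.mem_closure_oneAddEdge X k z
    -- The two homomorphisms agree on a subring of cycles containing all `1 + [a]`, which is
    -- everything.
    refine (Subring.closure_le (t := RingHom.eqLocus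
      ((Θ.comp Ψ).comp (Ideal.Quotient.mk (CobarPi.zeroBoundaries X k)))
      ((RingHom.id _).comp (Ideal.Quotient.mk (CobarPi.zeroBoundaries X k))))).2 ?_ hz
    rintro _ ⟨a, rfl⟩
    change Θ (Ψ (CobarPi.AQuot.mk X k _)) = CobarPi.AQuot.mk X k _
    rw [hΨ, hΘ]
  exact ⟨RingEquiv.ofRingHom Θ Ψ h2 h1, hΘ⟩
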